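/- Let $d\ge 0$ and $p\ge 0$ be integers, and let $\mathcal P_{2,ac}(\mathbb R^d)$ be the set of Borel probability measures on $\mathbb R^d$ that are absolutely continuous with respect to Lebesgue measure and have finite second moment. For $\mu,\nu\in\mathcal P_{2,ac}(\mathbb R^d)$ put $$W_2^2(\mu,\nu)=\min_{T_\#\mu=\nu}\int_{\mathbb R^d}\|T(x)-x\|_2^2\,d\mu(x),$$ the minimum being over measurable maps $T:\mathbb R^d\to\mathbb R^d$ that push $\mu$ forward to $\nu$; a minimizer is called an optimal transport map from $\mu$ to $\nu$. Let the tangent space $T_\mu\mathcal P_{2,ac}(\mathbb R^d)$ be the closure of $\{\nabla\psi:\psi\in C_c^\infty(\mathbb R^d)\}$ in $L^2(\mu;\mathbb R^d)$, with the inner product $\langle u,v\rangle_\mu=\int\langle u(x),v(x)\rangle\,d\mu(x)$ and the norm $\|u\|_\mu=\langle u,u\rangle_\mu^{1/2}$. A gradient (Fréchet derivative) of $F:\mathcal P_{2,ac}(\mathbb R^d)\to\mathbb R$ at $\mu$ is a $v\in T_\mu\mathcal P_{2,ac}(\mathbb R^d)$ such that $$F(\nu)=F(\mu)+\langle v,T_{\mu\to\nu}-\mathrm{id}\rangle_\mu+o(W_2(\mu,\nu))\qquad\text{as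 } W_2(\mu,\nu)\to 0,\ \nu\in\mathcal P_{2,ac}(\mathbb R^d),$$ where $T_{\mu\to\nu}$ is the optimal transport map from $\mu$ to $\nu$. Let $\mu_0,\mu_1,\dots,\mu_p\in\mathcal P_{2,ac}(\mathbb R^d)$. For $\lambda$ in the simplex $\Delta^p=\{\lambda\in\mathbb R^p:\lambda_i\ge 0,\ \sum_i\lambda_i=1\}$ let $G_\lambda(\nu)=\sum_{i=1}^p\frac{\lambda_i}{2}W_2^2(\nu,\mu_i)$ for $\nu\in\mathcal P_{2,ac}(\mathbb R^d)$. Then, for each $i$, an optimal transport map $T_i$ from $\mu_0$ to $\mu_i$ exists and is unique $\mu_0$-almost everywhere. Let $A\in\mathbb R^{p\times p}$ be the Gram matrix with entries $$A_{ij}=\int_{\mathbb R^d}\langle T_i(x)-x,\,T_j(x)-x\rangle\,d\mu_0(x),$$ whose integrals converge absolutely. For every $\lambda\in\Delta^p$ the functional $G_\lambda$ has exactly one gradient $\nabla G_\lambda(\mu_0)$ at $\mu_0$, and $$\|\nabla G_\lambda(\mu_0)\|_{\mu_0}^2=\lambda^{T}A\lambda .$$ Furthermore, $A$ is positive semidefinite,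 $\lambda\mapsto\lambda^TA\lambda$ is convex on $\mathbb R^p$, and so $\lambda\mapsto\|\nabla G_\lambda(\mu_0)\|_{\mu_0}^2$ is convex on $\Delta^p$. -/

import Mathlib

open MeasureTheory

open scoped ENNReal ContDiff Gradient Matrix

/-- Absolutely continuous probability measures on `ℝ^d` (with its Euclidean structure) with finite
second moment. -/
structure P2ac (d : ℕ) where
  /-- the underlying Borel measure -/
  toMeasure : Measure (EuclideanSpace ℝ (Fin d))
  isProbabilityMeasure : IsProbabilityMeasure toMeasure
  absolutelyContinuous : toMeasure ≪ volume
  integrable_norm_sq : Integrable (fun x => ‖x‖ ^ 2) toMeasure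

instance P2ac.instIsProbabilityMeasure {d : ℕ} (μ : P2ac d) : IsProbabilityMeasure μ.toMeasure :=
  μ.isProbabilityMeasure

/-- `T` is a (measurable) transport map from `μ` to `ν`: the pushforward of `μ` by `T` is `ν`. -/
def IsTransportMap {d : ℕ} (μ ν : P2ac d)
    (T : EuclideanSpace ℝ (Fin d) → EuclideanSpace ℝ (Fin d)) : Prop :=
  Measurable T ∧ μ.toMeasure.map T = ν.toMeasure

/-- The quadratic transport cost `∫ ‖T x - x‖² dμ(x)`. -/
noncomputable def transportCost {d : ℕ} (μ : P2ac d)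
    (T : EuclideanSpace ℝ (Fin d) → EuclideanSpace ℝ (Fin d)) : ℝ≥0∞ :=
  ∫⁻ x, ‖T x - x‖ₑ ^ 2 ∂μ.toMeasure

/-- `T` is an optimal transport map from `μ` to `ν`: it attains the minimal quadratic cost among all
transport maps. -/
def IsOptimalMap {d : ℕ} (μ ν : P2ac d)
    (T : EuclideanSpace ℝ (Fin d) → EuclideanSpace ℝ (Fin d)) : Prop :=
  IsTransportMap μ ν T ∧ ∀ S, IsTransportMap μ ν S → transportCost μ T ≤ transportCost μ S

/-- The squared Wasserstein-2 distance, as the minimal cost of transport maps. -/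
noncomputable def W2sq {d : ℕ} (μ ν : P2ac d) : ℝ :=
  (⨅ (T) (_ : IsTransportMap μ ν T), transportCost μ T).toReal

/-- The Wasserstein-2 distance. -/
noncomputable def W2 {d : ℕ} (μ ν : P2ac d) : ℝ :=
  Real.sqrt (W2sq μ ν)

/-- The variance functional `G_λ(ν) = ∑ i, (λ i / 2) * W₂²(ν, μ i)`. -/
noncomputable def varianceFunctional {d p : ℕ} (μ : Fin p → P2ac d) (lam : Fin p → ℝ)
    (ν : P2ac d) : ℝ :=
  ∑ i, lam i / 2 * W2sq ν (μ i)

/-- The tangent space at `μ`: the closure in `L²(μ; ℝ^d)` of the gradients of smooth compactly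
supported functions. -/
def wassersteinTangent {d : ℕ} (μ : P2ac d) :
    Set (Lp (EuclideanSpace ℝ (Fin d)) 2 μ.toMeasure) :=
  closure {v | ∃ ψ : EuclideanSpace ℝ (Fin d) → ℝ,
    ContDiff ℝ ∞ ψ ∧ HasCompactSupport ψ ∧ v =ᵐ[μ.toMeasure] ∇ ψ}

/-- `v` is a gradient (Fréchet derivative) at `μ` of the functional `F` on the Wasserstein space: it
is a tangent vector at `μ`, and `F ν = F μ + ⟨v, T - id⟩_μ + o(W₂(μ, ν))` as `ν → μ`, where `T` is
the optimal transport map from `μ` to `ν`. -/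
def HasWassersteinGradient {d : ℕ} (F : P2ac d → ℝ) (μ : P2ac d)
    (v : Lp (EuclideanSpace ℝ (Fin d)) 2 μ.toMeasure) : Prop :=
  v ∈ wassersteinTangent μ ∧
    ∀ ε : ℝ, 0 < ε → ∃ δ : ℝ, 0 < δ ∧ ∀ (ν : P2ac d)
      (T : EuclideanSpace ℝ (Fin d) → EuclideanSpace ℝ (Fin d)),
      IsOptimalMap μ ν T → W2 μ ν < δ →
        |F ν - F μ - ∫ x, inner ℝ (v x) (T x - x) ∂μ.toMeasure| ≤ ε * W2 μ ν

open Classical in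
/-- The gradient of `F` at `μ` (with value `0` if there is none). -/
noncomputable def wassersteinGradient {d : ℕ} (F : P2ac d → ℝ) (μ : P2ac d) :
    Lp (EuclideanSpace ℝ (Fin d)) 2 μ.toMeasure :=
  if h : ∃ v, HasWassersteinGradient F μ v then h.choose else 0

/-- The matrix of the inner products in `L²(μ)` of the displacements `T i - id`. -/
noncomputable def displacementGram {d p : ℕ} (μ : P2ac d)
    (T : Fin p → EuclideanSpace ℝ (Fin d) → EuclideanSpace ℝ (Fin d)) :
    Matrix (Fin p) (Fin p) ℝ :=
  Matrix.of fun i j => ∫ x, inner ℝ (T i x - x) (T j x - x) ∂μ.toMeasure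

/-! The gradient of `G_λ` at `μ₀` is `-∑ λ_i (T_i - id)`; its squared norm expands into the Gram
form `λᵀAλ`, and a Gram form is the squared norm of a linear map, hence positive semidefinite and
convex. The work lies in justifying this gradient.

Brenier's theorem (`exists_isBrenierPair`) supplies the maps. Couplings form a weakly compact set,
so an optimal one exists; its support is cyclically monotone, so it lies in the contact set of a
convex potential and a dual potential. Convex functions are differentiable Lebesgue-a.e. on their
domain, which forces the coupling onto the graph of `∇ φ`. A vanishing duality gap makes a transport
map a near-subgradient, which gives both uniqueness and L² stability
(`IsBrenierPair.tendsto_eLpNorm`).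

Differentiability (`IsOptimalMap.W2sq_expansion`): for a nearby `ν` with displacement `t` from `μ`,
the map to `η` with displacement `a` gives `W₂²(ν, η) ≤ ‖a - t‖²`. Conversely, composing `μ → ν → η`
optimally gives a transport map of displacement `r` with `W₂²(ν, η) = ‖r - t‖²` and `‖r‖ ≥ ‖a‖`;
stability makes `r` close to `a`, so both bounds agree to first order.

Tangency (`IsBrenierPair.isTangentField`): `∇ φ` is a dominated limit of gradients of Lipschitz
functions, which are themselves limits of gradients of test functions.

Uniqueness (`HasWassersteinGradient.unique`): for a test function `ψ` and small `t`, `id + t ∇ ψ` is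
optimal onto its image, so two gradients have equal pairings with every `∇ ψ`; their difference lies
in the closure of these fields, hence is zero. -/

set_option linter.unusedSectionVars false

/-! ### Existence of optimal couplings. -/

section Coupling

open Filter Topology Set

open scoped NNReal

variable {E : Type*} [NormedAddCommGroup E] [InnerProductSpace ℝ E] [FiniteDimensional ℝ E]
  [MeasurableSpace E] [BorelSpace E]

/-- `γ` is a coupling (transport plan) of `μ` and `ν`. -/
structure IsCoupling (μ ν : Measure E) (γ : Measure (E × E)) : Prop where
  fst_eq : γ.fst = μ
  snd_eq : γ.snd = ν

/-- `γ` maximizes the correlation `∫ ⟪x, y⟫ dγ` among the couplings of `μ` and `ν`. -/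
structure IsOptimalCoupling (μ ν : Measure E) (γ : Measure (E × E)) : Prop
    extends IsCoupling μ ν γ where
  le : ∀ γ', IsCoupling μ ν γ' → ∫ z, inner ℝ z.1 z.2 ∂γ' ≤ ∫ z, inner ℝ z.1 z.2 ∂γ

variable {μ ν : Measure E} {γ : Measure (E × E)}

lemma IsCoupling.measurePreserving_fst (h : IsCoupling μ ν γ) :
    MeasurePreserving Prod.fst γ μ := ⟨measurable_fst, h.fst_eq⟩

lemma IsCoupling.measurePreserving_snd (h : IsCoupling μ ν γ) :
    MeasurePreserving Prod.snd γ ν := ⟨measurable_snd, h.snd_eq⟩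

lemma IsCoupling.isProbabilityMeasure [IsProbabilityMeasure μ] (h : IsCoupling μ ν γ) :
    IsProbabilityMeasure γ := by
  constructor
  rw [← preimage_univ (f := Prod.fst),
    h.measurePreserving_fst.measure_preimage MeasurableSet.univ.nullMeasurableSet, measure_univ]

lemma IsCoupling.memLp_fst (h : IsCoupling μ ν γ) (hμ : MemLp id 2 μ) :
    MemLp (Prod.fst : E × E → E) 2 γ :=
  hμ.comp_measurePreserving h.measurePreserving_fst

lemma IsCoupling.memLp_snd (h : IsCoupling μ ν γ) (hν : MemLp id 2 ν) :
    MemLp (Prod.snd : E × E → E) 2 γ :=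
  hν.comp_measurePreserving h.measurePreserving_snd

/-- The inner product of two square integrable functions is integrable. -/
lemma MeasureTheory.MemLp.integrable_inner' {α : Type*} {m : MeasurableSpace α} {P : Measure α}
    {f g : α → E} (hf : MemLp f 2 P) (hg : MemLp g 2 P) :
    Integrable (fun z => inner ℝ (f z) (g z)) P := by
  refine (hf.norm.integrable_mul hg.norm).mono (hf.1.inner hg.1) (ae_of_all _ fun z => ?_)
  simpa using abs_real_inner_le_norm (f z) (g z)

lemma IsCoupling.integrable_inner (h : IsCoupling μ ν γ) (hμ : MemLp id 2 μ)
    (hν : MemLp id 2 ν) : Integrable (fun z => inner ℝ z.1 z.2) γ :=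
  (h.memLp_fst hμ).integrable_inner' (h.memLp_snd hν)

lemma lintegral_enorm_sq_eq_ofReal {α : Type*} {m : MeasurableSpace α} {P : Measure α} {f : α → E}
    (hf : MemLp f 2 P) :
    ∫⁻ x, ‖f x‖ₑ ^ 2 ∂P = ENNReal.ofReal (∫ x, ‖f x‖ ^ 2 ∂P) := by
  rw [ofReal_integral_eq_lintegral_ofReal (hf.integrable_norm_pow (by norm_num))
    (ae_of_all _ fun _ => by positivity)]
  refine lintegral_congr fun x => ?_
  rw [ENNReal.ofReal_pow (norm_nonneg _), ofReal_norm]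

/-- The second moments depend only on the marginals, so minimizing the quadratic cost is the same as
maximizing the correlation. -/
lemma IsCoupling.integral_norm_sub_sq (h : IsCoupling μ ν γ) (hμ : MemLp id 2 μ)
    (hν : MemLp id 2 ν) :
    ∫ z, ‖z.2 - z.1‖ ^ 2 ∂γ
      = ∫ x, ‖x‖ ^ 2 ∂μ + ∫ y, ‖y‖ ^ 2 ∂ν - 2 * ∫ z, inner ℝ z.1 z.2 ∂γ := by
  have h1 := h.memLp_fst hμ
  have h2 := h.memLp_snd hν
  have e1 : ∫ x, ‖x‖ ^ 2 ∂μ = ∫ z, ‖z.1‖ ^ 2 ∂γ := by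
    rw [← h.fst_eq, Measure.fst, integral_map (by fun_prop) (by fun_prop)]
  have e2 : ∫ x, ‖x‖ ^ 2 ∂ν = ∫ z, ‖z.2‖ ^ 2 ∂γ := by
    rw [← h.snd_eq, Measure.snd, integral_map (by fun_prop) (by fun_prop)]
  have i1 := h1.integrable_norm_pow (p := 2) (by norm_num)
  have i2 := h2.integrable_norm_pow (p := 2) (by norm_num)
  have i3 := (h.integrable_inner hμ hν).const_mul 2
  rw [e1, e2, ← integral_const_mul, ← integral_add i1 i2,
    ← integral_sub (i1.fun_add i2) i3]
  congr with z
  rw [norm_sub_sq_real, real_inner_comm]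
  ring

/-- The integral of a nonnegative continuous function is lower semicontinuous in the measure. -/
lemma lowerSemicontinuous_lintegral {X : Type*} [TopologicalSpace X] [MeasurableSpace X]
    [OpensMeasurableSpace X] {f : X → ℝ≥0} (hf : Continuous f) :
    LowerSemicontinuous fun P : ProbabilityMeasure X => ∫⁻ x, f x ∂(P : Measure X) := by
  -- Truncation at height `n`: each truncated integral is weakly continuous, and their supremum is
  -- the full integral.
  let g : ℕ → BoundedContinuousFunction X ℝ≥0 := fun n =>
    BoundedContinuousFunction.mkOfBound ⟨fun x => min (f x) n, by fun_prop⟩ n (by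
      intro x y
      rw [NNReal.dist_eq, abs_sub_le_iff]
      have h1 : ((min (f x) n : ℝ≥0) : ℝ) ≤ n := by exact_mod_cast min_le_right _ _
      have h2 : ((min (f y) n : ℝ≥0) : ℝ) ≤ n := by exact_mod_cast min_le_right _ _
      have h3 : (0 : ℝ) ≤ ((min (f x) n : ℝ≥0) : ℝ) := NNReal.coe_nonneg _
      have h4 : (0 : ℝ) ≤ ((min (f y) n : ℝ≥0) : ℝ) := NNReal.coe_nonneg _
      simp only [ContinuousMap.coe_mk]
      constructor <;> linarith)
  have key : ∀ P : ProbabilityMeasure X,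
      ∫⁻ x, f x ∂(P : Measure X) = ⨆ n, ∫⁻ x, g n x ∂(P : Measure X) := by
    intro P
    rw [← lintegral_iSup]
    · refine lintegral_congr fun x => ?_
      apply le_antisymm
      · obtain ⟨n, hn⟩ := exists_nat_ge (f x)
        refine le_iSup_of_le n ?_
        simp [g, hn]
      · refine iSup_le fun n => ?_
        simp [g]
    · intro n
      exact ((g n).continuous.measurable).coe_nnreal_ennreal
    · intro m n hmn x
      simp only [g, BoundedContinuousFunction.mkOfBound_coe, ContinuousMap.coe_mk]
      gcongr
  simp_rw [key]
  exact lowerSemicontinuous_iSup fun n =>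
    (ProbabilityMeasure.continuous_lintegral_boundedContinuousFunction (g n)).lowerSemicontinuous

/-- Two probability measures with finite second moments have an optimal coupling. -/
theorem exists_isOptimalCoupling [IsProbabilityMeasure μ] [IsProbabilityMeasure ν]
    (hμ : MemLp id 2 μ) (hν : MemLp id 2 ν) : ∃ γ, IsOptimalCoupling μ ν γ := by
  let S : Set (ProbabilityMeasure (E × E)) := {P | IsCoupling μ ν (P : Measure (E × E))}
  have hne : S.Nonempty :=
    ⟨⟨μ.prod ν, inferInstance⟩, ⟨by simp, by simp⟩⟩
  -- Tightness of the two fixed marginals is inherited by all couplings; Prokhorov then gives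
  -- compactness.
  have htight : IsTightMeasureSet
      {((P : ProbabilityMeasure (E × E)) : Measure (E × E)) | P ∈ S} := by
    apply IsTightMeasureSet.prodMk
    · refine (isTightMeasureSet_singleton (μ := μ)).subset ?_
      rintro _ ⟨_, ⟨P, hP, rfl⟩, rfl⟩
      exact hP.fst_eq
    · refine (isTightMeasureSet_singleton (μ := ν)).subset ?_
      rintro _ ⟨_, ⟨P, hP, rfl⟩, rfl⟩
      exact hP.snd_eq
  have hclosed : IsClosed S := by
    let μ' : ProbabilityMeasure E := ⟨μ, inferInstance⟩
    let ν' : ProbabilityMeasure E := ⟨ν, inferInstance⟩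
    have : S = {P | P.map (measurable_fst (α := E) (β := E)).aemeasurable
        = μ'} ∩
        {P | P.map (measurable_snd (α := E) (β := E)).aemeasurable
        = ν'} := by
      ext P
      constructor
      · intro h
        exact ⟨Subtype.ext h.fst_eq, Subtype.ext h.snd_eq⟩
      · rintro ⟨h1, h2⟩
        exact ⟨congrArg Subtype.val h1, congrArg Subtype.val h2⟩
    rw [this]
    refine IsClosed.inter ?_ ?_
    · exact isClosed_eq (ProbabilityMeasure.continuous_map continuous_fst) continuous_const
    · exact isClosed_eq (ProbabilityMeasure.continuous_map continuous_snd) continuous_const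
  have hcomp : IsCompact S := by
    have := isCompact_closure_of_isTightMeasureSet htight
    rwa [hclosed.closure_eq] at this
  -- The cost is minimized, rather than the correlation maximized, because semicontinuity needs a
  -- nonnegative integrand.
  have hlsc := lowerSemicontinuous_lintegral (X := E × E)
    (f := fun z => ‖z.2 - z.1‖₊ ^ 2) (by fun_prop)
  obtain ⟨P, hP, hmin⟩ := (hlsc.lowerSemicontinuousOn S).exists_isMinOn hne hcomp
  refine ⟨P, hP, fun γ' hγ' => ?_⟩
  have : IsProbabilityMeasure γ' := hγ'.isProbabilityMeasure
  have hle : ∫⁻ z, (‖z.2 - z.1‖₊ ^ 2 : ℝ≥0) ∂(P : Measure (E × E)) ≤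
      ∫⁻ z, (‖z.2 - z.1‖₊ ^ 2 : ℝ≥0) ∂γ' :=
    isMinOn_iff.1 hmin (⟨γ', this⟩ : ProbabilityMeasure (E × E)) hγ'
  simp only [ENNReal.coe_pow] at hle
  have h1 := lintegral_enorm_sq_eq_ofReal ((hP.memLp_snd hν).sub (hP.memLp_fst hμ))
  have h2 := lintegral_enorm_sq_eq_ofReal ((hγ'.memLp_snd hν).sub (hγ'.memLp_fst hμ))
  simp only [Pi.sub_apply] at h1 h2
  change ∫⁻ z, ‖z.2 - z.1‖ₑ ^ 2 ∂(P : Measure (E × E)) ≤ ∫⁻ z, ‖z.2 - z.1‖ₑ ^ 2 ∂γ' at hle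
  rw [h1, h2, ENNReal.ofReal_le_ofReal_iff (integral_nonneg fun _ => by positivity),
    hP.integral_norm_sub_sq hμ hν, hγ'.integral_norm_sub_sq hμ hν] at hle
  linarith

end Coupling

/-! ### Cyclic monotonicity of optimal couplings. -/

section CyclicMonotonicity

open Filter Topology Set

open scoped NNReal

variable {E : Type*} [NormedAddCommGroup E] [InnerProductSpace ℝ E] [FiniteDimensional ℝ E]
  [MeasurableSpace E] [BorelSpace E]

variable {μ ν : Measure E} {γ : Measure (E × E)}

lemma MeasureTheory.Measure.pi_pos_of_mem_support {ι X : Type*} [Fintype ι]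
    [TopologicalSpace X] [MeasurableSpace X] {P : Measure X} [IsProbabilityMeasure P]
    {A : Set (ι → X)} (hA : IsOpen A) {z : ι → X} (hz : ∀ i, z i ∈ P.support) (hzA : z ∈ A) :
    0 < Measure.pi (fun _ => P) A := by
  obtain ⟨t, ht, hsub⟩ : ∃ t : ι → Set X, (∀ i, t i ∈ 𝓝 (z i)) ∧
      Set.pi univ t ⊆ A := by
    have := hA.mem_nhds hzA
    rw [nhds_pi, Filter.mem_pi'] at this
    obtain ⟨_, t, ht, hs⟩ := this
    exact ⟨t, ht, fun w hw => hs fun i _ => hw i (mem_univ i)⟩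
  refine lt_of_lt_of_le ?_ (measure_mono hsub)
  rw [Measure.pi_pi]
  refine pos_iff_ne_zero.2 (Finset.prod_ne_zero_iff.2 fun i _ => ?_)
  exact ((Measure.mem_support_iff_forall _).1 (hz i) _ (ht i)).ne'

/-- The support of an optimal coupling is cyclically monotone. -/
theorem IsOptimalCoupling.sum_inner_le [IsProbabilityMeasure μ]
    (h : IsOptimalCoupling μ ν γ) (hμ : MemLp id 2 μ) (hν : MemLp id 2 ν)
    {ι : Type*} [Fintype ι] (z : ι → E × E) (hz : ∀ i, z i ∈ γ.support) (σ : Equiv.Perm ι) :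
    ∑ i, inner ℝ (z i).1 (z (σ i)).2 ≤ ∑ i, inner ℝ (z i).1 (z i).2 := by
  by_contra! hlt
  have : IsProbabilityMeasure γ := h.isProbabilityMeasure
  have hne : Nonempty ι := by
    by_contra hne
    rw [not_nonempty_iff] at hne
    simp at hlt
  -- The violation is an open condition, so it has positive probability for independent samples of
  -- `γ`.
  let A : Set (ι → E × E) :=
    {w | ∑ i, inner ℝ (w i).1 (w i).2 < ∑ i, inner ℝ (w i).1 (w (σ i)).2}
  have hAo : IsOpen A := isOpen_lt (by fun_prop) (by fun_prop)
  have hApos : 0 < Measure.pi (fun _ => γ) A := Measure.pi_pos_of_mem_support hAo hz hlt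
  set P : Measure (ι → E × E) := (Measure.pi (fun _ => γ)).restrict A with hP
  -- Competitor: remove the mass of the sampled pairs (`a`) and put back the pairs rewired by `σ`
  -- (`b`). The factor `c` keeps the removed mass below `γ`; permuting the second coordinates
  -- preserves both marginals.
  let a : ι → Measure (E × E) := fun i => P.map (fun w => w i)
  let b : ι → Measure (E × E) := fun i => P.map (fun w => ((w i).1, (w (σ i)).2))
  let c : ℝ≥0∞ := (Fintype.card ι : ℝ≥0∞)⁻¹
  have hcard : (Fintype.card ι : ℝ≥0∞) ≠ 0 := by simp
  have hc0 : c ≠ 0 := by simp [c]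
  have hct : c ≠ ⊤ := by simp [c]
  have ha : ∀ i, a i ≤ γ := by
    intro i
    have h1 : (Measure.pi (fun _ : ι => γ)).map (fun w => w i) = γ :=
      (measurePreserving_eval (fun _ : ι => γ) i).map_eq
    rw [← h1]
    exact Measure.map_mono Measure.restrict_le_self (measurable_pi_apply i)
  have hM : c • ∑ i, a i ≤ γ := by
    calc c • ∑ i, a i ≤ c • ∑ i : ι, γ := by
          gcongr with i
          exact ha i
      _ = γ := by
        rw [Finset.sum_const, Finset.card_univ, ← Nat.cast_smul_eq_nsmul ℝ≥0∞, smul_smul,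
          ENNReal.inv_mul_cancel hcard (by simp), one_smul]
  have hfin : IsFiniteMeasure (c • ∑ i, a i) := isFiniteMeasure_of_le γ hM
  set ρ := γ - c • ∑ i, a i with hρ
  have hρM : ρ + c • ∑ i, a i = γ := Measure.sub_add_cancel_of_le hM
  have hfst : (c • ∑ i, b i).map Prod.fst = (c • ∑ i, a i).map Prod.fst := by
    simp_rw [Measure.map_smul, Measure.map_finset_sum measurable_fst.aemeasurable, a, b]
    congr 1
    refine Finset.sum_congr rfl fun i _ => ?_
    rw [Measure.map_map measurable_fst (by fun_prop), Measure.map_map measurable_fst (by fun_prop)]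
    rfl
  have hsnd : (c • ∑ i, b i).map Prod.snd = (c • ∑ i, a i).map Prod.snd := by
    simp_rw [Measure.map_smul, Measure.map_finset_sum measurable_snd.aemeasurable, a, b]
    congr 1
    rw [← Equiv.sum_comp σ fun i => (P.map fun w => w i).map Prod.snd]
    refine Finset.sum_congr rfl fun i _ => ?_
    rw [Measure.map_map measurable_snd (by fun_prop), Measure.map_map measurable_snd (by fun_prop)]
    rfl
  have hcoup : IsCoupling μ ν (ρ + c • ∑ i, b i) := by
    constructor
    · rw [Measure.fst, Measure.map_add _ _ measurable_fst, hfst,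
        ← Measure.map_add _ _ measurable_fst, hρM]
      exact h.fst_eq
    · rw [Measure.snd, Measure.map_add _ _ measurable_snd, hsnd,
        ← Measure.map_add _ _ measurable_snd, hρM]
      exact h.snd_eq
  have hint := h.integrable_inner hμ hν
  have hint' := hcoup.integrable_inner hμ hν
  have hle := h.le _ hcoup
  have hia : Integrable (fun z : E × E => inner ℝ z.1 z.2) (∑ i, a i) := by
    rw [integrable_finsetSum_measure]
    exact fun i _ => hint.mono_measure (ha i)
  have hib : Integrable (fun z : E × E => inner ℝ z.1 z.2) (∑ i, b i) := by
    have := hint'.mono_measure (Measure.le_add_left le_rfl : c • ∑ i, b i ≤ _)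
    exact (integrable_smul_measure hc0 hct).1 this
  have hiρ : Integrable (fun z : E × E => inner ℝ z.1 z.2) ρ :=
    hint.mono_measure (hρM ▸ Measure.le_add_right le_rfl)
  rw [integral_add_measure hiρ (hib.smul_measure hct)] at hle
  nth_rewrite 1 [← hρM] at hle
  rw [integral_add_measure hiρ (hia.smul_measure hct), add_le_add_iff_left,
    integral_smul_measure, integral_smul_measure, smul_eq_mul, smul_eq_mul,
    mul_le_mul_iff_right₀ (ENNReal.toReal_pos hc0 hct)] at hle
  rw [integrable_finsetSum_measure] at hia hib
  rw [integral_finsetSum_measure (by simpa using hib),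
    integral_finsetSum_measure (by simpa using hia)] at hle
  have hma : ∀ i, ∫ z, inner ℝ z.1 z.2 ∂(a i) = ∫ w, inner ℝ (w i).1 (w i).2 ∂P := fun i =>
    integral_map (measurable_pi_apply i).aemeasurable (by fun_prop)
  have hmb : ∀ i, ∫ z, inner ℝ z.1 z.2 ∂(b i) = ∫ w, inner ℝ (w i).1 (w (σ i)).2 ∂P := fun i =>
    integral_map (by fun_prop) (by fun_prop)
  have hja : ∀ i, Integrable (fun w : ι → E × E => inner ℝ (w i).1 (w i).2) P := fun i =>
    (integrable_map_measure (f := fun w : ι → E × E => w i)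
      (g := fun z : E × E => inner ℝ z.1 z.2) (by fun_prop)
      (measurable_pi_apply i).aemeasurable).1 (hia i (Finset.mem_univ i))
  have hjb : ∀ i, Integrable (fun w : ι → E × E => inner ℝ (w i).1 (w (σ i)).2) P := fun i =>
    (integrable_map_measure (f := fun w : ι → E × E => ((w i).1, (w (σ i)).2))
      (g := fun z : E × E => inner ℝ z.1 z.2) (by fun_prop) (by fun_prop)).1
      (hib i (Finset.mem_univ i))
  simp_rw [hma, hmb] at hle
  rw [← integral_finsetSum _ fun i _ => hja i, ← integral_finsetSum _ fun i _ => hjb i] at hle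
  -- On `A` the rewiring strictly gains correlation, against optimality.
  have hpos : 0 < ∫ w in A, (∑ i, inner ℝ (w i).1 (w (σ i)).2 - ∑ i, inner ℝ (w i).1 (w i).2)
      ∂(Measure.pi (fun _ => γ)) := by
    rw [setIntegral_pos_iff_support_of_nonneg_ae]
    · refine lt_of_lt_of_le hApos (measure_mono fun w hw => ⟨?_, hw⟩)
      exact (sub_pos.2 hw).ne'
    · exact (ae_restrict_iff' hAo.measurableSet).2 (ae_of_all _ fun w hw => (sub_pos.2 hw).le)
    · exact (integrable_finsetSum _ fun i _ => hjb i).sub (integrable_finsetSum _ fun i _ => hja i)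
  rw [integral_sub (integrable_finsetSum _ fun i _ => hjb i)
    (integrable_finsetSum _ fun i _ => hja i)] at hpos
  linarith

end CyclicMonotonicity

/-! ### Convex potentials and their subgradients. -/

section Potentials

open Filter Topology Set

open scoped NNReal

variable {E : Type*} [NormedAddCommGroup E] [InnerProductSpace ℝ E] [FiniteDimensional ℝ E]
  [MeasurableSpace E] [BorelSpace E]

/-- The supremum of a family of continuous functions, as a real function on the measurable set
where the family is bounded above. -/
lemma exists_measurable_sup {J : Type*} [Nonempty J] {X : Type*} [TopologicalSpace X]
    [MeasurableSpace X] [OpensMeasurableSpace X] (f : J → X → ℝ) (hf : ∀ j, Continuous (f j)) :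
    ∃ (φ : X → ℝ) (D : Set X), Measurable φ ∧ MeasurableSet D ∧
      (∀ x ∈ D, ∀ j, f j x ≤ φ x) ∧ ∀ x C, (∀ j, f j x ≤ C) → x ∈ D ∧ φ x ≤ C := by
  -- In `EReal` the supremum is lower semicontinuous, hence measurable, even where it is infinite;
  -- `D` is the finiteness set.
  let Φ : X → EReal := fun x => ⨆ j, (f j x : EReal)
  have hΦ : Measurable Φ := by
    apply LowerSemicontinuous.measurable
    exact lowerSemicontinuous_iSup fun j =>
      (continuous_coe_real_ereal.comp (hf j)).lowerSemicontinuous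
  have hbot : ∀ x, Φ x ≠ ⊥ := by
    intro x hx
    obtain ⟨j⟩ := ‹Nonempty J›
    have : (f j x : EReal) ≤ Φ x := le_iSup (fun j => (f j x : EReal)) j
    rw [hx, le_bot_iff] at this
    exact EReal.coe_ne_bot _ this
  refine ⟨fun x => (Φ x).toReal, {x | Φ x ≠ ⊤}, hΦ.ereal_toReal,
    (hΦ (measurableSet_singleton ⊤)).compl, ?_, ?_⟩
  · intro x hx j
    have : (f j x : EReal) ≤ Φ x := le_iSup (fun j => (f j x : EReal)) j
    rw [← EReal.coe_toReal hx (hbot x)] at this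
    exact_mod_cast this
  · intro x C hC
    have hle : Φ x ≤ (C : EReal) := iSup_le fun j => by exact_mod_cast hC j
    have hx : Φ x ≠ ⊤ := (hle.trans_lt (EReal.coe_lt_top C)).ne
    refine ⟨hx, ?_⟩
    rw [← EReal.coe_toReal hx (hbot x)] at hle
    exact_mod_cast hle

/-- A pair of potentials `φ`, `ψ`, finite on `D` and `D'`, that is admissible in the dual of the
problem of maximizing the correlation. -/
structure IsPotentialPair (φ ψ : E → ℝ) (D D' : Set E) : Prop where
  measurable_left : Measurable φ
  measurable_right : Measurable ψ
  measurableSet_left : MeasurableSet D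
  measurableSet_right : MeasurableSet D'
  convexOn : ConvexOn ℝ D φ
  inner_le : ∀ x ∈ D, ∀ y ∈ D', inner ℝ x y ≤ φ x + ψ y

/-- The value at `x` of the affine function attached to the chain `z 0, …, z n`. -/
def chainValue (z : ℕ → E × E) (n : ℕ) (x : E) : ℝ :=
  ∑ i ∈ Finset.range n, inner ℝ ((z (i + 1)).1 - (z i).1) (z i).2 + inner ℝ (x - (z n).1) (z n).2

/-- Appending `w` to chains is what makes `w.2` a subgradient at `w.1` of the supremum over chains.
-/
lemma chainValue_extend (z : ℕ → E × E) (n : ℕ) (w : E × E) (x : E) :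
    chainValue (fun i => if i ≤ n then z i else w) (n + 1) x =
      chainValue z n w.1 + inner ℝ (x - w.1) w.2 := by
  unfold chainValue
  rw [Finset.sum_range_succ]
  congr 1
  · congr 1
    · refine Finset.sum_congr rfl fun i hi => ?_
      have hi' := Finset.mem_range.1 hi
      simp [hi'.le, Nat.succ_le_of_lt hi']
    · simp
  · simp

/-- This is cyclic monotonicity for the cyclic shift of the chain, written as a sum of increments.
-/
lemma chainValue_closed_nonpos {Γ : Set (E × E)}
    (hΓ : ∀ (n : ℕ) (z : Fin n → E × E), (∀ i, z i ∈ Γ) → ∀ σ : Equiv.Perm (Fin n),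
      ∑ i, inner ℝ (z i).1 (z (σ i)).2 ≤ ∑ i, inner ℝ (z i).1 (z i).2)
    {z : ℕ → E × E} (hz : ∀ i, z i ∈ Γ) (n : ℕ) : chainValue z n (z 0).1 ≤ 0 := by
  have h := hΓ (n + 1) (fun i => z i) (fun i => hz i) (finRotate (n + 1)).symm
  rw [← Equiv.sum_comp (finRotate (n + 1)), Fin.sum_univ_castSucc, Fin.sum_univ_castSucc] at h
  simp only [Equiv.symm_apply_apply] at h
  simp only [finRotate_last, Fin.val_last, Fin.val_castSucc, Fin.val_zero] at h
  have e : ∀ i : Fin n, ((finRotate (n + 1) i.castSucc : Fin (n + 1)) : ℕ) = i + 1 := by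
    intro i
    rw [coe_finRotate_of_ne_last (Fin.castSucc_lt_last i).ne, Fin.val_castSucc]
  simp only [e] at h
  rw [Fin.sum_univ_eq_sum_range (fun i => inner ℝ (z (i + 1)).1 (z i).2) n,
    Fin.sum_univ_eq_sum_range (fun i => inner ℝ (z i).1 (z i).2) n] at h
  unfold chainValue
  simp only [inner_sub_left, Finset.sum_sub_distrib]
  linarith

/-- Rockafellar's theorem: a cyclically monotone set is contained in the contact set of a pair of
potentials. -/
theorem exists_isPotentialPair {Γ : Set (E × E)} (hne : Γ.Nonempty)
    (hΓ : ∀ (n : ℕ) (z : Fin n → E × E), (∀ i, z i ∈ Γ) → ∀ σ : Equiv.Perm (Fin n),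
      ∑ i, inner ℝ (z i).1 (z (σ i)).2 ≤ ∑ i, inner ℝ (z i).1 (z i).2) :
    ∃ φ ψ D D', IsPotentialPair φ ψ D D' ∧
      ∀ z ∈ Γ, z.1 ∈ D ∧ z.2 ∈ D' ∧ φ z.1 + ψ z.2 = inner ℝ z.1 z.2 := by
  obtain ⟨z₀, hz₀⟩ := hne
  let J := {p : (ℕ → E × E) × ℕ // (∀ i, p.1 i ∈ Γ) ∧ p.1 0 = z₀}
  have : Nonempty J := ⟨⟨(fun _ => z₀, 0), fun _ => hz₀, rfl⟩⟩
  obtain ⟨φ, D, hφm, hDm, hle, hsup⟩ :=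
    exists_measurable_sup (fun (j : J) x => chainValue j.1.1 j.1.2 x)
      (fun j => by unfold chainValue; fun_prop)
  have hext : ∀ (j : J), ∀ w ∈ Γ, ∃ j' : J, ∀ x, chainValue j'.1.1 j'.1.2 x =
      chainValue j.1.1 j.1.2 w.1 + inner ℝ (x - w.1) w.2 := by
    intro j w hw
    refine ⟨⟨(fun i => if i ≤ j.1.2 then j.1.1 i else w, j.1.2 + 1), ?_, ?_⟩, fun x => ?_⟩
    · intro i
      dsimp only
      split_ifs
      exacts [j.2.1 i, hw]
    · simpa using j.2.2
    · exact chainValue_extend _ _ _ _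
  have hD : ∀ w ∈ Γ, w.1 ∈ D := by
    intro w hw
    -- The bound comes from appending `w` to a chain and closing it at its starting point `z₀`.
    refine (hsup w.1 (-inner ℝ (z₀.1 - w.1) w.2) fun j => ?_).1
    obtain ⟨j', hj'⟩ := hext j w hw
    have h1 := chainValue_closed_nonpos hΓ j'.2.1 j'.1.2
    rw [j'.2.2, hj'] at h1
    linarith
  have hsub : ∀ w ∈ Γ, ∀ x ∈ D, φ w.1 + inner ℝ (x - w.1) w.2 ≤ φ x := by
    intro w hw x hx
    have := (hsup w.1 (φ x - inner ℝ (x - w.1) w.2) fun j => ?_).2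
    · linarith
    · obtain ⟨j', hj'⟩ := hext j w hw
      have := hle x hx j'
      rw [hj'] at this
      linarith
  have hconv : ConvexOn ℝ D φ := by
    have key : ∀ x ∈ D, ∀ y ∈ D, ∀ a b : ℝ, 0 ≤ a → 0 ≤ b → a + b = 1 →
        a • x + b • y ∈ D ∧ φ (a • x + b • y) ≤ a • φ x + b • φ y := by
      intro x hx y hy a b ha hb hab
      refine hsup _ _ fun j => ?_
      have h1 := mul_le_mul_of_nonneg_left (hle x hx j) ha
      have h2 := mul_le_mul_of_nonneg_left (hle y hy j) hb
      refine le_trans (le_of_eq ?_) (add_le_add h1 h2)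
      unfold chainValue
      simp only [inner_sub_left, inner_add_left, real_inner_smul_left]
      linear_combination (inner ℝ (j.1.1 j.1.2).1 (j.1.1 j.1.2).2 -
        ∑ i ∈ Finset.range j.1.2, (inner ℝ (j.1.1 (i + 1)).1 (j.1.1 i).2 -
          inner ℝ (j.1.1 i).1 (j.1.1 i).2)) * hab
    exact ⟨fun x hx y hy a b ha hb hab => (key x hx y hy a b ha hb hab).1,
      fun x hx y hy a b ha hb hab => (key x hx y hy a b ha hb hab).2⟩
  have : Nonempty D := ⟨⟨z₀.1, hD z₀ hz₀⟩⟩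
  -- `ψ` is the Legendre transform of `φ`; the contact equality is the subgradient inequality
  -- `hsub`.
  obtain ⟨ψ, D', hψm, hDm', hle', hsup'⟩ :=
    exists_measurable_sup (fun (x : D) y => inner ℝ (x : E) y - φ x) (fun j => by fun_prop)
  refine ⟨φ, ψ, D, D', ⟨hφm, hψm, hDm, hDm', hconv, ?_⟩, ?_⟩
  · intro x hx y hy
    have := hle' y hy ⟨x, hx⟩
    dsimp only at this
    linarith
  · intro z hz
    have h1 := hsup' z.2 (inner ℝ z.1 z.2 - φ z.1) fun x => by
      have := hsub z hz x x.2
      rw [inner_sub_left] at this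
      linarith
    have h2 := hle' z.2 h1.1 ⟨z.1, hD z hz⟩
    refine ⟨hD z hz, h1.1, le_antisymm ?_ ?_⟩
    · linarith [h1.2]
    · dsimp only at h2
      linarith

/-- A convex function on a set of a finite-dimensional space is differentiable at almost every
point of the set. -/
lemma ConvexOn.ae_differentiableAt {φ : E → ℝ} {D : Set E} (h : ConvexOn ℝ D φ)
    (vol : Measure E) [vol.IsAddHaarMeasure] :
    ∀ᵐ x ∂vol, x ∈ D → x ∈ interior D ∧ DifferentiableAt ℝ φ x := by
  -- The frontier of a convex set is null; in the interior `φ` is locally Lipschitz and Rademacher's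
  -- theorem applies.
  have h1 : ∀ᵐ x ∂vol, x ∉ frontier D := measure_eq_zero_iff_ae_notMem.1 (h.1.addHaar_frontier vol)
  have h2 : ∀ᵐ x ∂vol, ¬ (x ∈ interior D ∧ ¬ DifferentiableAt ℝ φ x) := by
    refine (measure_eq_zero_iff_ae_notMem (μ := vol)
      (s := {x | x ∈ interior D ∧ ¬ DifferentiableAt ℝ φ x})).1
      (measure_null_of_locally_null _ fun x hx => ?_)
    obtain ⟨K, t, ht, hL⟩ := h.locallyLipschitzOn_interior hx.1
    rw [isOpen_interior.nhdsWithin_eq hx.1] at ht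
    obtain ⟨U, hUt, hUo, hxU⟩ := mem_nhds_iff.1 ht
    refine ⟨U ∩ {x | x ∈ interior D ∧ ¬ DifferentiableAt ℝ φ x},
      by
        rw [inter_comm]
        exact inter_mem_nhdsWithin _ (hUo.mem_nhds hxU), ?_⟩
    have := (hL.mono hUt).ae_differentiableWithinAt_of_mem (μ := vol)
    refine measure_mono_null ?_ (ae_iff.1 this)
    rintro y ⟨hyU, _, hy⟩ hcon
    exact hy ((hcon hyU).differentiableAt (hUo.mem_nhds hyU))
  filter_upwards [h1, h2] with x hx1 hx2 hxD
  have hi : x ∈ interior D := by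
    by_contra hi
    exact hx1 ⟨subset_closure hxD, hi⟩
  refine ⟨hi, ?_⟩
  by_contra hd
  exact hx2 ⟨hi, hd⟩

/-- At a point of differentiability the gradient is a strongly exposed subgradient: the vectors that
nearly satisfy the subgradient inequality are close to it. -/
lemma norm_sub_gradient_le_of_near_subgradient {φ : E → ℝ} {D : Set E} {x : E}
    (hx : x ∈ interior D) (hd : DifferentiableAt ℝ φ x) {η : ℝ} (hη : 0 < η) :
    ∃ r > 0, ∀ y e, (∀ z ∈ D, φ x + inner ℝ (z - x) y - e ≤ φ z) → ‖y - ∇ φ x‖ ≤ η + e / r := by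
  have hg := hd.hasGradientAt
  rw [hasGradientAt_iff_isLittleO] at hg
  have h1 := hg.def hη
  have h2 : ∀ᶠ z in 𝓝 x, z ∈ D := mem_interior_iff_mem_nhds.1 hx
  obtain ⟨r, hr, hball⟩ := Metric.eventually_nhds_iff_ball.1 (h1.and h2)
  refine ⟨r / 2, by positivity, fun y e hy => ?_⟩
  set w := y - ∇ φ x with hw
  by_cases hw0 : w = 0
  · have := hy x (hball x (Metric.mem_ball_self hr)).2
    rw [sub_self, inner_zero_left] at this
    have he : 0 ≤ e := by linarith
    rw [hw0, norm_zero]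
    positivity
  have hwn : 0 < ‖w‖ := norm_pos_iff.2 hw0
  -- Moving from `x` by `r / 2` along `w` makes the excess slope contribute `r / 2 * ‖w‖`, which
  -- only the differentiability error and the slack `e` can pay for.
  set z := x + (r / 2 / ‖w‖) • w with hz
  have hzx : z - x = (r / 2 / ‖w‖) • w := by simp [hz]
  have hnz : ‖z - x‖ = r / 2 := by
    rw [hzx, norm_smul, Real.norm_of_nonneg (by positivity)]
    field_simp
  obtain ⟨ha, hb⟩ := hball z (by rw [Metric.mem_ball, dist_eq_norm, hnz]; linarith)
  have hc := hy z hb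
  rw [hnz, Real.norm_eq_abs] at ha
  have ha' := le_of_abs_le ha
  have hsplit : inner ℝ (z - x) y = inner ℝ (∇ φ x) (z - x) + r / 2 * ‖w‖ := by
    have : y = ∇ φ x + w := by simp [hw]
    rw [this, inner_add_right, real_inner_comm]
    congr 1
    rw [hzx, real_inner_smul_left, real_inner_self_eq_norm_sq]
    field_simp
  have hfin : r / 2 * ‖w‖ ≤ η * (r / 2) + e := by linarith
  have : ‖w‖ ≤ (η * (r / 2) + e) / (r / 2) := by
    rw [le_div_iff₀ (by positivity)]
    linarith
  refine this.trans (le_of_eq ?_)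
  field_simp

lemma eq_gradient_of_subgradient {φ : E → ℝ} {D : Set E} {x y : E}
    (hx : x ∈ interior D) (hd : DifferentiableAt ℝ φ x)
    (h : ∀ z ∈ D, φ x + inner ℝ (z - x) y ≤ φ z) : y = ∇ φ x := by
  rw [← sub_eq_zero, ← norm_le_zero_iff]
  refine le_of_forall_pos_le_add fun η hη => ?_
  obtain ⟨r, hr, H⟩ := norm_sub_gradient_le_of_near_subgradient hx hd hη
  simpa using H y 0 (by simpa using h)

/-- Near-subgradients at a point of differentiability converge to the gradient. -/
lemma tendsto_gradient_of_near_subgradient {φ : E → ℝ} {D : Set E} {x : E}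
    (hx : x ∈ interior D) (hd : DifferentiableAt ℝ φ x) {ι : Type*} {l : Filter ι} {y : ι → E}
    {e : ι → ℝ} (he : Tendsto e l (𝓝 0))
    (h : ∀ n, ∀ z ∈ D, φ x + inner ℝ (z - x) (y n) - e n ≤ φ z) :
    Tendsto y l (𝓝 (∇ φ x)) := by
  rw [Metric.tendsto_nhds]
  intro η hη
  obtain ⟨r, hr, H⟩ := norm_sub_gradient_le_of_near_subgradient hx hd (half_pos hη)
  filter_upwards [he.eventually (gt_mem_nhds (show 0 < r * (η / 2) by positivity))] with n hn
  rw [dist_eq_norm]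
  have h1 := H (y n) (e n) (h n)
  have h2 : e n / r < η / 2 := by
    rw [div_lt_iff₀ hr]
    linarith
  linarith

end Potentials

/-! ### Brenier's theorem and stability of optimal maps. -/

section Brenier

open Filter Topology Set

open scoped NNReal

variable {E : Type*} [NormedAddCommGroup E] [InnerProductSpace ℝ E] [FiniteDimensional ℝ E]
  [MeasurableSpace E] [BorelSpace E]

variable {μ ν : Measure E} {φ ψ : E → ℝ} {D D' : Set E}

/-- Potentials `φ`, `ψ` such that `∇ φ` is the optimal transport map from `μ` to `ν`. -/
structure IsBrenierPair (μ ν : Measure E) (φ ψ : E → ℝ) (D D' : Set E) : Prop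
    extends IsPotentialPair φ ψ D D' where
  ae_differentiableAt : ∀ᵐ x ∂μ, x ∈ interior D ∧ DifferentiableAt ℝ φ x
  ae_mem : ∀ᵐ y ∂ν, y ∈ D'
  ae_contact : ∀ᵐ x ∂μ, ∇ φ x ∈ D' ∧ φ x + ψ (∇ φ x) = inner ℝ x (∇ φ x)
  map_gradient : μ.map (∇ φ) = ν
  le : ∀ γ, IsCoupling μ ν γ → ∫ z, inner ℝ z.1 z.2 ∂γ ≤ ∫ x, inner ℝ x (∇ φ x) ∂μ

lemma measurable_gradient (φ : E → ℝ) : Measurable (∇ φ) :=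
  (InnerProductSpace.toDual ℝ E).symm.continuous.measurable.comp (measurable_fderiv ℝ φ)

/-- Brenier's theorem. -/
theorem exists_isBrenierPair [IsProbabilityMeasure μ] [IsProbabilityMeasure ν]
    (hμ : MemLp id 2 μ) (hν : MemLp id 2 ν) (vol : Measure E) [vol.IsAddHaarMeasure]
    (hac : μ ≪ vol) : ∃ φ ψ D D', IsBrenierPair μ ν φ ψ D D' := by
  obtain ⟨γ, hγ⟩ := exists_isOptimalCoupling hμ hν
  have : IsProbabilityMeasure γ := hγ.isProbabilityMeasure
  obtain ⟨φ, ψ, D, D', h, hc⟩ := exists_isPotentialPair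
    (Measure.nonempty_support (IsProbabilityMeasure.ne_zero γ))
    (fun n z hz σ => hγ.sum_inner_le hμ hν z hz σ)
  have hcγ : ∀ᵐ z ∂γ, z.1 ∈ D ∧ z.2 ∈ D' ∧ φ z.1 + ψ z.2 = inner ℝ z.1 z.2 := by
    filter_upwards [Measure.support_mem_ae (μ := γ)] with z hz using hc z hz
  have hD : ∀ᵐ x ∂μ, x ∈ D := by
    rw [← hγ.fst_eq, Measure.fst, ae_map_iff measurable_fst.aemeasurable
      (p := fun x => x ∈ D) h.measurableSet_left]
    exact hcγ.mono fun z hz => hz.1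
  have hD' : ∀ᵐ y ∂ν, y ∈ D' := by
    rw [← hγ.snd_eq, Measure.snd, ae_map_iff measurable_snd.aemeasurable
      (p := fun y => y ∈ D') h.measurableSet_right]
    exact hcγ.mono fun z hz => hz.2.1
  have hdiff : ∀ᵐ x ∂μ, x ∈ interior D ∧ DifferentiableAt ℝ φ x := by
    filter_upwards [hD, hac.ae_le (h.convexOn.ae_differentiableAt vol)] with x hx hx' using hx' hx
  -- Contact makes `z.2` a subgradient of `φ` at `z.1`, so differentiability leaves only one choice.
  have hgraph : ∀ᵐ z ∂γ, z.2 = ∇ φ z.1 := by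
    filter_upwards [hcγ, hγ.measurePreserving_fst.quasiMeasurePreserving.ae hdiff] with z hz hz'
    refine eq_gradient_of_subgradient hz'.1 hz'.2 fun x hx => ?_
    have := h.inner_le x hx z.2 hz.2.1
    rw [inner_sub_left]
    linarith [hz.2.2]
  have hm := measurable_gradient φ
  refine ⟨φ, ψ, D, D', h, hdiff, hD', ?_, ?_, fun γ' hγ' => (hγ.le γ' hγ').trans (le_of_eq ?_)⟩
  · have hφ := h.measurable_left
    have hψ := h.measurable_right
    rw [← hγ.fst_eq, Measure.fst, ae_map_iff (by fun_prop)]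
    · filter_upwards [hcγ, hgraph] with z hz hz'
      rw [← hz']
      exact hz.2
    · exact (hm h.measurableSet_right).inter (measurableSet_eq_fun (by fun_prop) (by fun_prop))
  · rw [← hγ.fst_eq, ← hγ.snd_eq, Measure.fst, Measure.snd, Measure.map_map hm measurable_fst]
    exact Measure.map_congr (hgraph.mono fun z hz => hz.symm)
  · rw [← hγ.fst_eq, Measure.fst, integral_map (by fun_prop) (by fun_prop)]
    exact integral_congr_ae (hgraph.mono fun z hz => by simp only [hz])

namespace IsBrenierPair

lemma memLp_of_map_eq {R : E → E} (hR : Measurable R) (hν : MemLp id 2 ν) (h : μ.map R = ν) :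
    MemLp R 2 μ := hν.comp_measurePreserving ⟨hR, h⟩

lemma memLp_gradient (h : IsBrenierPair μ ν φ ψ D D') (hν : MemLp id 2 ν) : MemLp (∇ φ) 2 μ :=
  memLp_of_map_eq (measurable_gradient φ) hν h.map_gradient

/-- Admissibility against one fixed contact pair `(x₁, y₁)` sandwiches `ψ ∘ ∇ φ` between integrable
functions. -/
lemma integrable_right [IsProbabilityMeasure μ] (h : IsBrenierPair μ ν φ ψ D D')
    (hμ : MemLp id 2 μ) (hν : MemLp id 2 ν) : Integrable ψ ν := by
  obtain ⟨x₁, hx₁, hc₁⟩ := (h.ae_differentiableAt.and h.ae_contact).exists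
  have hx₁D := interior_subset hx₁.1
  set y₁ := ∇ φ x₁
  have hm := measurable_gradient φ
  have hψ := h.measurable_right
  have hT := h.memLp_gradient hν
  rw [← h.map_gradient, integrable_map_measure hψ.aestronglyMeasurable hm.aemeasurable]
  have i1 : Integrable (fun x => inner ℝ x₁ (∇ φ x) - φ x₁) μ :=
    ((memLp_const x₁).integrable_inner' hT).sub (integrable_const _)
  have i2 : Integrable (fun x => inner ℝ x (∇ φ x) - inner ℝ x y₁ + ψ y₁) μ :=
    ((hμ.integrable_inner' hT).sub (hμ.integrable_inner' (memLp_const y₁))).add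
      (integrable_const _)
  refine (i1.abs.add i2.abs).mono' (hψ.comp hm).aestronglyMeasurable ?_
  filter_upwards [h.ae_differentiableAt, h.ae_contact] with x hx hc
  have h1 := h.inner_le x₁ hx₁D _ hc.1
  have h2 := h.inner_le x (interior_subset hx.1) y₁ hc₁.1
  have a1 := neg_abs_le (inner ℝ x₁ (∇ φ x) - φ x₁)
  have a2 := le_abs_self (inner ℝ x (∇ φ x) - inner ℝ x y₁ + ψ y₁)
  have a3 := abs_nonneg (inner ℝ x₁ (∇ φ x) - φ x₁)
  have a4 := abs_nonneg (inner ℝ x (∇ φ x) - inner ℝ x y₁ + ψ y₁)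
  simp only [Function.comp_apply, Pi.add_apply, Real.norm_eq_abs]
  rw [abs_le]
  constructor <;> linarith [hc.2]

/-- The duality gap of a transport map: it is nonnegative and its integral is the loss of
correlation. -/
lemma gap [IsProbabilityMeasure μ] (h : IsBrenierPair μ ν φ ψ D D') (hμ : MemLp id 2 μ)
    (hν : MemLp id 2 ν) {R : E → E} (hR : Measurable R) (hRν : μ.map R = ν) :
    (∀ᵐ x ∂μ, R x ∈ D' ∧ 0 ≤ φ x + ψ (R x) - inner ℝ x (R x)) ∧
    Integrable (fun x => φ x + ψ (R x) - inner ℝ x (R x)) μ ∧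
    ∫ x, (φ x + ψ (R x) - inner ℝ x (R x)) ∂μ =
      ∫ x, inner ℝ x (∇ φ x) ∂μ - ∫ x, inner ℝ x (R x) ∂μ := by
  have hψ := h.integrable_right hμ hν
  have hm := measurable_gradient φ
  have hRD : ∀ᵐ x ∂μ, R x ∈ D' :=
    (MeasurePreserving.mk hR hRν).quasiMeasurePreserving.ae h.ae_mem
  have j1 : Integrable (fun x => ψ (R x)) μ :=
    (MeasurePreserving.mk hR hRν).integrable_comp_of_integrable hψ
  have j2 : Integrable (fun x => ψ (∇ φ x)) μ :=
    (MeasurePreserving.mk hm h.map_gradient).integrable_comp_of_integrable hψ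
  have j3 : Integrable (fun x => inner ℝ x (R x)) μ :=
    hμ.integrable_inner' (memLp_of_map_eq hR hν hRν)
  have j4 : Integrable (fun x => inner ℝ x (∇ φ x)) μ :=
    hμ.integrable_inner' (h.memLp_gradient hν)
  have k1 : Integrable (fun x => inner ℝ x (∇ φ x) - inner ℝ x (R x)) μ := j4.sub j3
  have k2 : Integrable (fun x => ψ (R x) - ψ (∇ φ x)) μ := j1.sub j2
  -- Contact eliminates `φ`; the two `ψ` terms then cancel in the integral because `R` and `∇ φ`
  -- have the same law.
  have heq : (fun x => φ x + ψ (R x) - inner ℝ x (R x)) =ᵐ[μ] fun x =>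
      (inner ℝ x (∇ φ x) - inner ℝ x (R x)) + (ψ (R x) - ψ (∇ φ x)) := by
    filter_upwards [h.ae_contact] with x hx
    linarith [hx.2]
  refine ⟨?_, (k1.add k2).congr heq.symm, ?_⟩
  · filter_upwards [hRD, h.ae_differentiableAt] with x hx hd
    refine ⟨hx, ?_⟩
    linarith [h.inner_le x (interior_subset hd.1) _ hx]
  · rw [integral_congr_ae heq, integral_add k1 k2, integral_sub j4 j3,
      integral_sub j1 j2]
    have e1 : ∫ x, ψ (R x) ∂μ = ∫ y, ψ y ∂ν := by
      rw [← hRν, integral_map (by fun_prop) h.measurable_right.aestronglyMeasurable]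
    have e2 : ∫ x, ψ (∇ φ x) ∂μ = ∫ y, ψ y ∂ν := by
      rw [← h.map_gradient, integral_map (by fun_prop) h.measurable_right.aestronglyMeasurable]
    rw [e1, e2]
    ring

/-- Stability: transport maps that are asymptotically optimal converge to the optimal map. -/
theorem tendsto_eLpNorm [IsProbabilityMeasure μ] (h : IsBrenierPair μ ν φ ψ D D')
    (hμ : MemLp id 2 μ) (hν : MemLp id 2 ν) {R : ℕ → E → E} (hR : ∀ n, Measurable (R n))
    (hRν : ∀ n, μ.map (R n) = ν)
    (hlim : Tendsto (fun n => ∫ x, inner ℝ x (R n x) ∂μ) atTop (𝓝 (∫ x, inner ℝ x (∇ φ x) ∂μ))) :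
    Tendsto (fun n => eLpNorm (R n - ∇ φ) 2 μ) atTop (𝓝 0) := by
  have hm := measurable_gradient φ
  refine tendsto_of_subseq_tendsto fun ns hns => ?_
  -- `e n x` is exactly the slack with which `R (ns n) x` is a subgradient of `φ` at `x`. It tends
  -- to zero in L¹, hence a.e. along a subsequence.
  let e : ℕ → E → ℝ := fun n x => φ x + ψ (R (ns n) x) - inner ℝ x (R (ns n) x)
  have hgap := fun n => h.gap hμ hν (hR (ns n)) (hRν (ns n))
  have hL1 : Tendsto (fun n => eLpNorm (e n - fun _ => 0) 1 μ) atTop (𝓝 0) := by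
    have heq : ∀ n, eLpNorm (e n - fun _ => 0) 1 μ =
        ENNReal.ofReal (∫ x, inner ℝ x (∇ φ x) ∂μ - ∫ x, inner ℝ x (R (ns n) x) ∂μ) := by
      intro n
      rw [← (hgap n).2.2, ofReal_integral_eq_lintegral_ofReal (hgap n).2.1
        ((hgap n).1.mono fun x hx => hx.2), eLpNorm_one_eq_lintegral_enorm]
      refine lintegral_congr_ae ((hgap n).1.mono fun x hx => ?_)
      simp only [Pi.sub_apply, sub_zero, e]
      rw [← ofReal_norm, Real.norm_of_nonneg hx.2]
    simp_rw [heq]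
    have := (hlim.comp hns).const_sub (∫ x, inner ℝ x (∇ φ x) ∂μ)
    rw [sub_self] at this
    simpa using (ENNReal.tendsto_ofReal this)
  have hmeas := tendstoInMeasure_of_tendsto_eLpNorm one_ne_zero
    (fun n => (hgap n).2.1.aestronglyMeasurable) aestronglyMeasurable_const hL1
  obtain ⟨ms, hms, hae⟩ := hmeas.exists_seq_tendsto_ae
  refine ⟨ms, ?_⟩
  have hconv : ∀ᵐ x ∂μ, Tendsto (fun n => R (ns (ms n)) x) atTop (𝓝 (∇ φ x)) := by
    filter_upwards [hae, h.ae_differentiableAt, ae_all_iff.2 fun n => (hgap n).1] with x hx hd hg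
    refine tendsto_gradient_of_near_subgradient hd.1 hd.2 hx fun n z hz => ?_
    have := h.inner_le z hz _ (hg (ms n)).1
    simp only [inner_sub_left]
    linarith
  refine tendsto_Lp_finite_of_tendsto_ae (by norm_num) (by norm_num)
    (fun n => (hR _).aestronglyMeasurable) (h.memLp_gradient hν) ?_ hconv
  -- All the maps have law `ν`, so they are uniformly integrable and a.e. convergence upgrades to
  -- L².
  have hUI := ProbabilityTheory.MemLp.uniformIntegrable_of_identDistrib
    (f := fun n => R (ns (ms n))) (j := 0) (p := 2) (μ := μ) (by norm_num) (by norm_num)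
    (memLp_of_map_eq (hR _) hν (hRν _))
    (fun n => ⟨(hR _).aemeasurable, (hR _).aemeasurable, by rw [hRν, hRν]⟩)
  exact hUI.unifIntegrable

/-- Stability applied to a constant sequence. -/
lemma ae_eq_gradient [IsProbabilityMeasure μ] (h : IsBrenierPair μ ν φ ψ D D')
    (hμ : MemLp id 2 μ) (hν : MemLp id 2 ν) {R : E → E} (hR : Measurable R)
    (hRν : μ.map R = ν) (heq : ∫ x, inner ℝ x (R x) ∂μ = ∫ x, inner ℝ x (∇ φ x) ∂μ) :
    R =ᵐ[μ] ∇ φ := by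
  have := h.tendsto_eLpNorm hμ hν (R := fun _ => R) (fun _ => hR) (fun _ => hRν)
    (by rw [heq]; exact tendsto_const_nhds)
  have h0 := tendsto_nhds_unique tendsto_const_nhds this
  rw [eLpNorm_eq_zero_iff (by have := measurable_gradient φ; fun_prop) (by norm_num)] at h0
  filter_upwards [h0] with x hx
  simpa [sub_eq_zero] using hx

end IsBrenierPair

end Brenier

/-! ### Displacements in L² and the first-order expansion of the squared distance. -/

section Wasserstein

open Filter Topology Set

open scoped NNReal

variable {d : ℕ} {μ ν η : P2ac d} {T T' R S : EuclideanSpace ℝ (Fin d) → EuclideanSpace ℝ (Fin d)}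

lemma P2ac.memLp_id (μ : P2ac d) : MemLp id 2 μ.toMeasure :=
  (memLp_two_iff_integrable_sq_norm aestronglyMeasurable_id).2 μ.integrable_norm_sq

lemma P2ac.exists_isBrenierPair (μ ν : P2ac d) :
    ∃ φ ψ D D', IsBrenierPair μ.toMeasure ν.toMeasure φ ψ D D' :=
  _root_.exists_isBrenierPair μ.memLp_id ν.memLp_id volume μ.absolutelyContinuous

namespace IsTransportMap

lemma measurePreserving (h : IsTransportMap μ ν T) :
    MeasurePreserving T μ.toMeasure ν.toMeasure := ⟨h.1, h.2⟩

lemma memLp (h : IsTransportMap μ ν T) : MemLp T 2 μ.toMeasure :=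
  ν.memLp_id.comp_measurePreserving h.measurePreserving

lemma memLp_sub_id (h : IsTransportMap μ ν T) : MemLp (fun x => T x - x) 2 μ.toMeasure :=
  h.memLp.sub μ.memLp_id

/-- The displacement `T - id` as an element of `L²(μ)`. -/
noncomputable def disp (h : IsTransportMap μ ν T) :
    Lp (EuclideanSpace ℝ (Fin d)) 2 μ.toMeasure := h.memLp_sub_id.toLp

lemma coeFn_disp (h : IsTransportMap μ ν T) : h.disp =ᵐ[μ.toMeasure] fun x => T x - x :=
  h.memLp_sub_id.coeFn_toLp

lemma comp (hS : IsTransportMap ν η S) (hT : IsTransportMap μ ν T) :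
    IsTransportMap μ η (S ∘ T) :=
  ⟨hS.1.comp hT.1, (hS.measurePreserving.comp hT.measurePreserving).map_eq⟩

lemma isCoupling_pair (hT : IsTransportMap μ ν T) (hS : IsTransportMap μ η S) :
    IsCoupling ν.toMeasure η.toMeasure (μ.toMeasure.map fun x => (T x, S x)) := by
  have := hT.1
  have := hS.1
  constructor
  · rw [Measure.fst, Measure.map_map measurable_fst (by fun_prop)]
    exact hT.2
  · rw [Measure.snd, Measure.map_map measurable_snd (by fun_prop)]
    exact hS.2

end IsTransportMap

lemma IsTransportMap.id (μ : P2ac d) : IsTransportMap μ μ id := ⟨measurable_id, Measure.map_id⟩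

namespace IsTransportMap

lemma integral_norm_sub_sq (hT : IsTransportMap μ ν T) (hS : IsTransportMap μ η S) :
    ∫ x, ‖S x - T x‖ ^ 2 ∂μ.toMeasure =
      ∫ x, ‖x‖ ^ 2 ∂ν.toMeasure + ∫ x, ‖x‖ ^ 2 ∂η.toMeasure
        - 2 * ∫ x, inner ℝ (T x) (S x) ∂μ.toMeasure := by
  have h := (hT.isCoupling_pair hS).integral_norm_sub_sq ν.memLp_id η.memLp_id
  have := hT.1
  have := hS.1
  rwa [integral_map (by fun_prop) (by fun_prop), integral_map (by fun_prop) (by fun_prop)] at h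

lemma inner_disp (hT : IsTransportMap μ ν T) (hS : IsTransportMap μ η S) :
    inner ℝ hT.disp hS.disp = ∫ x, inner ℝ (T x - x) (S x - x) ∂μ.toMeasure := by
  rw [L2.inner_def]
  refine integral_congr_ae ?_
  filter_upwards [hT.coeFn_disp, hS.coeFn_disp] with x h1 h2
  rw [h1, h2]

lemma inner_coeFn_disp (hT : IsTransportMap μ ν T)
    (v : Lp (EuclideanSpace ℝ (Fin d)) 2 μ.toMeasure) :
    inner ℝ v hT.disp = ∫ x, inner ℝ (v x) (T x - x) ∂μ.toMeasure := by
  rw [L2.inner_def]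
  refine integral_congr_ae ?_
  filter_upwards [hT.coeFn_disp] with x h1
  rw [h1]

lemma norm_disp_sub_sq (hT : IsTransportMap μ ν T) (hS : IsTransportMap μ η S) :
    ‖hS.disp - hT.disp‖ ^ 2 = ∫ x, ‖S x - T x‖ ^ 2 ∂μ.toMeasure := by
  rw [← real_inner_self_eq_norm_sq, L2.inner_def]
  refine integral_congr_ae ?_
  filter_upwards [hT.coeFn_disp, hS.coeFn_disp, Lp.coeFn_sub hS.disp hT.disp] with x h1 h2 h3
  rw [h3, Pi.sub_apply, h1, h2, real_inner_self_eq_norm_sq, sub_sub_sub_cancel_right]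

lemma norm_disp_sq (hT : IsTransportMap μ ν T) :
    ‖hT.disp‖ ^ 2 = ∫ x, ‖T x - x‖ ^ 2 ∂μ.toMeasure := by
  rw [← real_inner_self_eq_norm_sq, hT.inner_disp hT]
  simp_rw [real_inner_self_eq_norm_sq]

lemma norm_disp_sub (hT : IsTransportMap μ ν T) (hS : IsTransportMap μ η S) :
    ‖hS.disp - hT.disp‖ = (eLpNorm (S - T) 2 μ.toMeasure).toReal := by
  rw [Lp.norm_def]
  congr 1
  refine eLpNorm_congr_ae ?_
  filter_upwards [hT.coeFn_disp, hS.coeFn_disp, Lp.coeFn_sub hS.disp hT.disp] with x h1 h2 h3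
  rw [h3, Pi.sub_apply, h1, h2, sub_sub_sub_cancel_right, Pi.sub_apply]

lemma norm_disp_sq_eq (hT : IsTransportMap μ ν T) :
    ‖hT.disp‖ ^ 2 = ∫ x, ‖x‖ ^ 2 ∂μ.toMeasure + ∫ x, ‖x‖ ^ 2 ∂ν.toMeasure
        - 2 * ∫ x, inner ℝ x (T x) ∂μ.toMeasure := by
  rw [hT.norm_disp_sq]
  exact (IsTransportMap.id μ).integral_norm_sub_sq hT

lemma transportCost_eq (hT : IsTransportMap μ ν T) :
    transportCost μ T = ENNReal.ofReal (‖hT.disp‖ ^ 2) := by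
  rw [hT.norm_disp_sq, transportCost, lintegral_enorm_sq_eq_ofReal hT.memLp_sub_id]

lemma transportCost_le_iff (hT : IsTransportMap μ ν T) (hS : IsTransportMap μ ν S) :
    transportCost μ T ≤ transportCost μ S ↔
      ∫ x, inner ℝ x (S x) ∂μ.toMeasure ≤ ∫ x, inner ℝ x (T x) ∂μ.toMeasure := by
  rw [hT.transportCost_eq, hS.transportCost_eq, ENNReal.ofReal_le_ofReal_iff (by positivity),
    hT.norm_disp_sq_eq, hS.norm_disp_sq_eq]
  constructor <;> intro h <;> linarith

end IsTransportMap

section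

variable {φ ψ : EuclideanSpace ℝ (Fin d) → ℝ} {D D' : Set (EuclideanSpace ℝ (Fin d))}

lemma IsBrenierPair.isTransportMap (h : IsBrenierPair μ.toMeasure ν.toMeasure φ ψ D D') :
    IsTransportMap μ ν (∇ φ) := ⟨measurable_gradient φ, h.map_gradient⟩

lemma IsBrenierPair.isOptimalMap (h : IsBrenierPair μ.toMeasure ν.toMeasure φ ψ D D') :
    IsOptimalMap μ ν (∇ φ) := by
  refine ⟨h.isTransportMap, fun S hS => (h.isTransportMap.transportCost_le_iff hS).2 ?_⟩
  have := h.le _ ((IsTransportMap.id μ).isCoupling_pair hS)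
  have hm := hS.1
  rwa [integral_map (by fun_prop) (by fun_prop)] at this

lemma IsOptimalMap.ae_eq_gradient (hT : IsOptimalMap μ ν T)
    (h : IsBrenierPair μ.toMeasure ν.toMeasure φ ψ D D') : T =ᵐ[μ.toMeasure] ∇ φ := by
  refine h.ae_eq_gradient μ.memLp_id ν.memLp_id hT.1.1 hT.1.2 (le_antisymm ?_ ?_)
  · exact (h.isTransportMap.transportCost_le_iff hT.1).1 (h.isOptimalMap.2 _ hT.1)
  · exact (hT.1.transportCost_le_iff h.isTransportMap).1 (hT.2 _ h.isTransportMap)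

end

/-- Existence and uniqueness of the optimal transport map. -/
theorem exists_isOptimalMap (μ ν : P2ac d) : ∃ T, IsOptimalMap μ ν T ∧
    ∀ T', IsOptimalMap μ ν T' → T' =ᵐ[μ.toMeasure] T := by
  obtain ⟨φ, ψ, D, D', h⟩ := μ.exists_isBrenierPair ν
  exact ⟨∇ φ, h.isOptimalMap, fun T' hT' => hT'.ae_eq_gradient h⟩

lemma IsOptimalMap.W2sq_eq (hT : IsOptimalMap μ ν T) : W2sq μ ν = ‖hT.1.disp‖ ^ 2 := by
  have : (⨅ (S) (_ : IsTransportMap μ ν S), transportCost μ S) = transportCost μ T :=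
    le_antisymm (iInf₂_le T hT.1) (le_iInf₂ hT.2)
  exact (congrArg ENNReal.toReal (this.trans hT.1.transportCost_eq)).trans
    (ENNReal.toReal_ofReal (by positivity))

lemma IsOptimalMap.W2_eq (hT : IsOptimalMap μ ν T) : W2 μ ν = ‖hT.1.disp‖ := by
  rw [W2, hT.W2sq_eq, Real.sqrt_sq (norm_nonneg _)]

lemma IsOptimalMap.norm_disp_le (hT : IsOptimalMap μ ν T) (hS : IsTransportMap μ ν S) :
    ‖hT.1.disp‖ ≤ ‖hS.disp‖ := by
  have := hT.2 S hS
  rw [hT.1.transportCost_eq, hS.transportCost_eq,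
    ENNReal.ofReal_le_ofReal_iff (by positivity)] at this
  exact le_of_sq_le_sq this (norm_nonneg _)

/-- The law of `(T, S)` is a coupling that need not come from a map, whereas `W2sq` ranges over
maps; Brenier's map beats all couplings. -/
lemma W2sq_le (hT : IsTransportMap μ ν T) (hS : IsTransportMap μ η S) :
    W2sq ν η ≤ ‖hS.disp - hT.disp‖ ^ 2 := by
  obtain ⟨φ, ψ, D, D', h⟩ := ν.exists_isBrenierPair η
  have h1 := h.le _ (hT.isCoupling_pair hS)
  have := hT.1
  have := hS.1
  rw [integral_map (by fun_prop) (by fun_prop)] at h1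
  rw [h.isOptimalMap.W2sq_eq, h.isTransportMap.norm_disp_sq_eq, hT.norm_disp_sub_sq hS,
    hT.integral_norm_sub_sq hS]
  linarith

/-- Nearly optimal transport maps are close to the optimal one. -/
theorem IsOptimalMap.stability (hT : IsOptimalMap μ ν T) {ε : ℝ} (hε : 0 < ε) :
    ∃ δ > 0, ∀ (R) (hR : IsTransportMap μ ν R), ‖hR.disp‖ ≤ ‖hT.1.disp‖ + δ →
      ‖hR.disp - hT.1.disp‖ ≤ ε := by
  obtain ⟨φ, ψ, D, D', h⟩ := μ.exists_isBrenierPair ν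
  have hTφ := hT.ae_eq_gradient h
  by_contra! hcon
  choose R hR hle hlt using fun n : ℕ => hcon (1 / ((n : ℝ) + 1)) Nat.one_div_pos_of_nat
  have hnorm : Tendsto (fun n => ‖(hR n).disp‖) atTop (𝓝 ‖hT.1.disp‖) := by
    refine tendsto_of_tendsto_of_tendsto_of_le_of_le tendsto_const_nhds
      (by simpa using tendsto_one_div_add_atTop_nhds_zero_nat.const_add ‖hT.1.disp‖)
      (fun n => hT.norm_disp_le (hR n)) hle
  have hlim : Tendsto (fun n => ∫ x, inner ℝ x (R n x) ∂μ.toMeasure) atTop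
      (𝓝 (∫ x, inner ℝ x (∇ φ x) ∂μ.toMeasure)) := by
    have e1 : ∀ n, ∫ x, inner ℝ x (R n x) ∂μ.toMeasure =
        (∫ x, ‖x‖ ^ 2 ∂μ.toMeasure + ∫ x, ‖x‖ ^ 2 ∂ν.toMeasure - ‖(hR n).disp‖ ^ 2) / 2 := by
      intro n
      rw [(hR n).norm_disp_sq_eq]
      ring
    have e2 : ∫ x, inner ℝ x (∇ φ x) ∂μ.toMeasure =
        (∫ x, ‖x‖ ^ 2 ∂μ.toMeasure + ∫ x, ‖x‖ ^ 2 ∂ν.toMeasure - ‖hT.1.disp‖ ^ 2) / 2 := by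
      have : ∫ x, inner ℝ x (∇ φ x) ∂μ.toMeasure = ∫ x, inner ℝ x (T x) ∂μ.toMeasure :=
        integral_congr_ae (hTφ.mono fun x hx => by simp only [hx])
      rw [hT.1.norm_disp_sq_eq, this]
      ring
    simp_rw [e1, e2]
    exact ((hnorm.pow 2).const_sub _).div_const 2
  have hconv := h.tendsto_eLpNorm μ.memLp_id ν.memLp_id (fun n => (hR n).1) (fun n => (hR n).2) hlim
  have hconv' : Tendsto (fun n => ‖(hR n).disp - hT.1.disp‖) atTop (𝓝 0) := by
    have e : ∀ n, ‖(hR n).disp - hT.1.disp‖ = (eLpNorm (R n - ∇ φ) 2 μ.toMeasure).toReal := by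
      intro n
      rw [hT.1.norm_disp_sub (hR n)]
      congr 1
      exact eLpNorm_congr_ae (hTφ.mono fun x hx => by simp only [Pi.sub_apply, hx])
    simp_rw [e]
    exact (ENNReal.tendsto_toReal ENNReal.zero_ne_top).comp hconv
  exact absurd (ge_of_tendsto' hconv' fun n => (hlt n).le) (not_le.2 hε)

/-- First order expansion of `ν ↦ W₂²(ν, η) / 2` at `μ`. -/
theorem IsOptimalMap.W2sq_expansion (hT : IsOptimalMap μ η T) {ε : ℝ} (hε : 0 < ε) :
    ∃ δ > 0, ∀ (ν : P2ac d) (T₀) (hT₀ : IsOptimalMap μ ν T₀), W2 μ ν < δ →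
      |W2sq ν η / 2 - W2sq μ η / 2 + inner ℝ hT.1.disp hT₀.1.disp| ≤ ε * W2 μ ν := by
  obtain ⟨δ, hδ, hstab⟩ := hT.stability hε
  -- `δ / 2` because the composed map has displacement at most `‖a‖ + 2 * ‖t‖`; `ε` absorbs the
  -- quadratic term `‖t‖ ^ 2`.
  refine ⟨min (δ / 2) ε, by positivity, fun ν T₀ hT₀ hW => ?_⟩
  obtain ⟨S, hS, -⟩ := exists_isOptimalMap ν η
  have hR := hS.1.comp hT₀.1
  have hub := W2sq_le hT₀.1 hT.1
  have hSR : W2sq ν η = ‖hR.disp - hT₀.1.disp‖ ^ 2 := by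
    rw [hS.W2sq_eq, hT₀.1.norm_disp_sub_sq hR, hS.1.norm_disp_sq]
    have hm := hS.1.1
    rw [← hT₀.1.2, integral_map hT₀.1.1.aemeasurable (by fun_prop)]
    rfl
  have hopt := hT.norm_disp_le hR
  rw [hT₀.W2_eq] at hW ⊢
  rw [hT.W2sq_eq]
  set a := hT.1.disp
  set t := hT₀.1.disp
  set r := hR.disp
  have ht1 : ‖t‖ < δ / 2 := hW.trans_le (min_le_left _ _)
  have ht2 : ‖t‖ < ε := hW.trans_le (min_le_right _ _)
  have hrt : ‖r - t‖ ≤ ‖a - t‖ := by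
    rw [hSR] at hub
    exact le_of_sq_le_sq hub (norm_nonneg _)
  have hra : ‖r‖ ≤ ‖a‖ + δ := by
    have h1 : ‖r‖ ≤ ‖r - t‖ + ‖t‖ := by simpa using norm_add_le (r - t) t
    have h2 : ‖a - t‖ ≤ ‖a‖ + ‖t‖ := norm_sub_le a t
    linarith
  have hra' : ‖r - a‖ ≤ ε := hstab _ hR hra
  have hcs : inner ℝ (r - a) t ≤ ‖r - a‖ * ‖t‖ := real_inner_le_norm _ _
  rw [inner_sub_left] at hcs
  have hcs' : ‖r - a‖ * ‖t‖ ≤ ε * ‖t‖ := by gcongr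
  have hsq : ‖t‖ ^ 2 ≤ ε * ‖t‖ := by
    rw [sq]
    gcongr
  have hsq0 : 0 ≤ ‖t‖ ^ 2 := by positivity
  -- Optimality removes the zeroth-order difference in the lower bound, leaving only `inner ℝ (r -
  -- a) t`, which stability controls.
  have hopt' : ‖a‖ ^ 2 ≤ ‖r‖ ^ 2 := by gcongr
  have e1 : ‖a - t‖ ^ 2 = ‖a‖ ^ 2 - 2 * inner ℝ a t + ‖t‖ ^ 2 := norm_sub_sq_real _ _
  have e2 : ‖r - t‖ ^ 2 = ‖r‖ ^ 2 - 2 * inner ℝ r t + ‖t‖ ^ 2 := norm_sub_sq_real _ _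
  rw [abs_le]
  constructor <;> linarith

end Wasserstein

/-! ### Optimal displacements are tangent. -/

section TangentSpace

open Filter Topology Set

open scoped NNReal Convolution

/-- Dominated convergence in `L^p`. -/
lemma MeasureTheory.tendsto_eLpNorm_of_dominated {α F : Type*} {m : MeasurableSpace α}
    [NormedAddCommGroup F] {P : Measure α} [IsFiniteMeasure P] {p : ℝ≥0∞} (hp : 1 ≤ p)
    (hp' : p ≠ ⊤) {f : ℕ → α → F} {g : α → F} {b : α → ℝ}
    (hf : ∀ n, AEStronglyMeasurable (f n) P) (hg : MemLp g p P) (hb : MemLp b p P)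
    (hle : ∀ n, ∀ᵐ x ∂P, ‖f n x‖ ≤ b x) (hlim : ∀ᵐ x ∂P, Tendsto (fun n => f n x) atTop (𝓝 (g x))) :
    Tendsto (fun n => eLpNorm (f n - g) p P) atTop (𝓝 0) := by
  refine tendsto_Lp_finite_of_tendsto_ae hp hp' hf hg ?_ hlim
  intro ε hε
  obtain ⟨δ, hδ, h⟩ := unifIntegrable_const (ι := ℕ) hp hp' hb hε
  refine ⟨δ, hδ, fun n s hs hPs => le_trans ?_ (h 0 s hs hPs)⟩
  refine eLpNorm_mono_ae ((hle n).mono fun x hx => ?_)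
  by_cases hxs : x ∈ s
  · simpa [hxs] using hx.trans (le_abs_self _)
  · simp [hxs]

lemma gradient_add_of_contDiff {F : Type*} [NormedAddCommGroup F] [InnerProductSpace ℝ F]
    [CompleteSpace F] {f g : F → ℝ} (hf : ContDiff ℝ ∞ f) (hg : ContDiff ℝ ∞ g) :
    ∇ (f + g) = ∇ f + ∇ g := by
  ext x
  have h1 := (hf.differentiable (by simp)) x
  have h2 := (hg.differentiable (by simp)) x
  simp [gradient, fderiv_add h1 h2]

lemma gradient_const_smul_of_contDiff {F : Type*} [NormedAddCommGroup F] [InnerProductSpace ℝ F]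
    [CompleteSpace F] {f : F → ℝ} (hf : ContDiff ℝ ∞ f) (c : ℝ) :
    ∇ (c • f) = c • ∇ f := by
  ext x
  have h1 := (hf.differentiable (by simp)) x
  simp [gradient, fderiv_const_smul h1]

lemma norm_gradient_le_of_lipschitz {F : Type*} [NormedAddCommGroup F] [InnerProductSpace ℝ F]
    [CompleteSpace F] {f : F → ℝ} {K : ℝ≥0} (hf : LipschitzWith K f) (x : F) : ‖∇ f x‖ ≤ K := by
  rw [gradient, LinearIsometryEquiv.norm_map]
  exact norm_fderiv_le_of_lipschitz ℝ hf

variable {d : ℕ}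

/-- The subspace of `L²(μ)` formed by the gradients of test functions. -/
def gradientSubmodule (μ : P2ac d) :
    Submodule ℝ (Lp (EuclideanSpace ℝ (Fin d)) 2 μ.toMeasure) where
  carrier := {v | ∃ ψ : EuclideanSpace ℝ (Fin d) → ℝ,
    ContDiff ℝ ∞ ψ ∧ HasCompactSupport ψ ∧ v =ᵐ[μ.toMeasure] ∇ ψ}
  zero_mem' := by
    refine ⟨0, contDiff_const, HasCompactSupport.zero, ?_⟩
    filter_upwards [Lp.coeFn_zero (EuclideanSpace ℝ (Fin d)) 2 μ.toMeasure] with x hx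
    rw [hx]
    simp [gradient]
  add_mem' := by
    rintro v w ⟨f, hf, hfc, hv⟩ ⟨g, hg, hgc, hw⟩
    refine ⟨f + g, hf.add hg, hfc.add hgc, ?_⟩
    filter_upwards [hv, hw, Lp.coeFn_add v w] with x h1 h2 h3
    rw [h3, gradient_add_of_contDiff hf hg, Pi.add_apply, Pi.add_apply, h1, h2]
  smul_mem' := by
    rintro c v ⟨f, hf, hfc, hv⟩
    refine ⟨c • f, contDiff_const.smul hf, hfc.smul_left (f := fun _ => c), ?_⟩
    filter_upwards [hv, Lp.coeFn_smul c v] with x h1 h2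
    rw [h2, gradient_const_smul_of_contDiff hf, Pi.smul_apply, Pi.smul_apply, h1]

lemma wassersteinTangent_eq (μ : P2ac d) :
    wassersteinTangent μ = (gradientSubmodule μ).topologicalClosure := rfl

/-- The vector field `f` represents an element of the tangent space at `μ`. -/
def IsTangentField (μ : P2ac d) (f : EuclideanSpace ℝ (Fin d) → EuclideanSpace ℝ (Fin d)) : Prop :=
  ∃ hf : MemLp f 2 μ.toMeasure, hf.toLp ∈ wassersteinTangent μ

variable {μ : P2ac d}

lemma IsTangentField.congr {f g : EuclideanSpace ℝ (Fin d) → EuclideanSpace ℝ (Fin d)}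
    (hf : IsTangentField μ f) (hfg : f =ᵐ[μ.toMeasure] g) : IsTangentField μ g := by
  obtain ⟨h, hm⟩ := hf
  exact ⟨h.ae_eq hfg, by rwa [← (MemLp.toLp_eq_toLp_iff h (h.ae_eq hfg)).2 hfg]⟩

lemma IsTangentField.of_dominated
    {f : ℕ → EuclideanSpace ℝ (Fin d) → EuclideanSpace ℝ (Fin d)}
    {g : EuclideanSpace ℝ (Fin d) → EuclideanSpace ℝ (Fin d)}
    {b : EuclideanSpace ℝ (Fin d) → ℝ} (hf : ∀ n, IsTangentField μ (f n))
    (hg : MemLp g 2 μ.toMeasure) (hb : MemLp b 2 μ.toMeasure)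
    (hle : ∀ n, ∀ᵐ x ∂μ.toMeasure, ‖f n x‖ ≤ b x)
    (hlim : ∀ᵐ x ∂μ.toMeasure, Tendsto (fun n => f n x) atTop (𝓝 (g x))) :
    IsTangentField μ g := by
  choose hfm hft using hf
  refine ⟨hg, isClosed_closure.mem_of_tendsto (f := fun n => (hfm n).toLp) (b := atTop) ?_
    (Eventually.of_forall hft)⟩
  rw [Lp.tendsto_Lp_iff_tendsto_eLpNorm'']
  exact tendsto_eLpNorm_of_dominated (by norm_num) (by norm_num) (fun n => (hfm n).1) hg hb hle hlim

lemma isTangentField_gradient_of_contDiff {ψ : EuclideanSpace ℝ (Fin d) → ℝ}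
    (hψ : ContDiff ℝ ∞ ψ) (hc : HasCompactSupport ψ) : IsTangentField μ (∇ ψ) := by
  obtain ⟨K, hK⟩ := ContDiff.lipschitzWith_of_hasCompactSupport hc hψ (by simp)
  have hm : MemLp (∇ ψ) 2 μ.toMeasure :=
    MemLp.of_bound (measurable_gradient ψ).aestronglyMeasurable K
      (ae_of_all _ fun x => norm_gradient_le_of_lipschitz hK x)
  exact ⟨hm, subset_closure ⟨ψ, hψ, hc, hm.coeFn_toLp⟩⟩

/-- The derivative of the mollification of a Lipschitz function is the mollification of the
derivative. -/
lemma LipschitzWith.hasFDerivAt_convolution {F : Type*} [NormedAddCommGroup F]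
    [NormedSpace ℝ F] [FiniteDimensional ℝ F] [MeasurableSpace F] [BorelSpace F]
    {vol : Measure F} [vol.IsAddHaarMeasure] {f ρ : F → ℝ} {K : ℝ≥0} (hf : LipschitzWith K f)
    (hρ : Continuous ρ) (hρc : HasCompactSupport ρ) (x : F) :
    HasFDerivAt (ρ ⋆[ContinuousLinearMap.lsmul ℝ ℝ, vol] f)
      ((ρ ⋆[ContinuousLinearMap.lsmul ℝ ℝ, vol] (fderiv ℝ f)) x) x := by
  have hρi : Integrable ρ vol := hρ.integrable_of_hasCompactSupport hρc
  have hd : ∀ᵐ t ∂vol, DifferentiableAt ℝ f (x - t) :=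
    (quasiMeasurePreserving_sub_left vol x).ae (hf.ae_differentiableAt (μ := vol))
  have hm := measurable_fderiv ℝ f
  have hcf := hf.continuous
  refine (hasFDerivAt_integral_of_dominated_loc_of_lip (μ := vol) (F := fun x t => ρ t • f (x - t))
    (F' := fun t => ρ t • fderiv ℝ f (x - t)) (bound := fun t => |ρ t| * K) (s := univ)
    univ_mem ?_ ?_ ?_ ?_ ?_ ?_).2
  · exact Eventually.of_forall fun y =>
      (by fun_prop : Continuous fun t => ρ t • f (y - t)).aestronglyMeasurable
  · exact (by fun_prop : Continuous fun t => ρ t • f (x - t)).integrable_of_hasCompactSupport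
      hρc.smul_right
  · exact hρ.aestronglyMeasurable.smul
      (hm.comp (measurable_const.sub measurable_id)).aestronglyMeasurable
  · refine ae_of_all _ fun t => (LipschitzWith.of_dist_le_mul fun y z => ?_).lipschitzOnWith
    rw [dist_eq_norm, ← smul_sub, norm_smul, ← dist_eq_norm]
    have := hf.dist_le_mul (y - t) (z - t)
    rw [dist_sub_right] at this
    simp only [Real.coe_nnabs, abs_mul, abs_abs, NNReal.abs_eq, Real.norm_eq_abs, mul_assoc]
    gcongr
  · exact hρi.abs.mul_const _
  · filter_upwards [hd] with t ht
    have h1 : HasFDerivAt (fun y => f (y - t)) (fderiv ℝ f (x - t)) x := by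
      simpa [Function.comp_def] using ht.hasFDerivAt.comp x ((hasFDerivAt_id x).sub_const t)
    exact h1.const_smul (ρ t)

/-- Gradients of compactly supported Lipschitz functions are tangent. -/
lemma LipschitzWith.isTangentField_gradient_of_hasCompactSupport
    {f : EuclideanSpace ℝ (Fin d) → ℝ} {K : ℝ≥0} (hf : LipschitzWith K f)
    (hc : HasCompactSupport f) : IsTangentField μ (∇ f) := by
  -- Bumps with shrinking radii in the fixed ratio 2: the bounded ratio is what the Lebesgue
  -- differentiation argument behind `hlim` needs.
  let β : ℕ → ContDiffBump (0 : EuclideanSpace ℝ (Fin d)) := fun n =>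
    ⟨1 / ((n : ℝ) + 1), 2 * (1 / ((n : ℝ) + 1)), Nat.one_div_pos_of_nat, by
      linarith [Nat.one_div_pos_of_nat (α := ℝ) (n := n)]⟩
  let L := ContinuousLinearMap.lsmul (R := ℝ) ℝ (E := ℝ)
  let ψ : ℕ → EuclideanSpace ℝ (Fin d) → ℝ := fun n => (β n).normed volume ⋆[L, volume] f
  have hρc : ∀ n, Continuous ((β n).normed volume) := fun n => (β n).continuous_normed
  have hρs : ∀ n, HasCompactSupport ((β n).normed volume) := fun n => (β n).hasCompactSupport_normed
  have hψs : ∀ n, ContDiff ℝ ∞ (ψ n) := fun n =>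
    (hρs n).contDiff_convolution_left L (β n).contDiff_normed hf.continuous.locallyIntegrable
  have hψc : ∀ n, HasCompactSupport (ψ n) := fun n => (hρs n).convolution L hc
  have hm := measurable_fderiv ℝ f
  have hgint : LocallyIntegrable (fderiv ℝ f) volume := by
    refine (locallyIntegrable_const (K : ℝ)).mono hm.aestronglyMeasurable (ae_of_all _ fun x => ?_)
    simpa using norm_fderiv_le_of_lipschitz ℝ hf
  have hder : ∀ n x, fderiv ℝ (ψ n) x =
      ((β n).normed volume ⋆[ContinuousLinearMap.lsmul ℝ ℝ, volume] (fderiv ℝ f)) x := fun n x =>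
    (hf.hasFDerivAt_convolution (hρc n) (hρs n) x).fderiv
  have hψK : ∀ n, LipschitzWith K (ψ n) := by
    intro n
    refine lipschitzWith_of_nnnorm_fderiv_le ((hψs n).differentiable (by simp)) fun x => ?_
    rw [hder, ← NNReal.coe_le_coe, coe_nnnorm]
    refine (norm_integral_le_of_norm_le (g := fun t => (β n).normed volume t * K)
      ((β n).integrable_normed.mul_const _) (ae_of_all _ fun t => ?_)).trans (le_of_eq ?_)
    · simp only [ContinuousLinearMap.lsmul_apply, norm_smul,
        Real.norm_of_nonneg ((β n).nonneg_normed t)]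
      exact mul_le_mul_of_nonneg_left (norm_fderiv_le_of_lipschitz ℝ hf) ((β n).nonneg_normed t)
    · rw [integral_mul_const, (β n).integral_normed, one_mul]
  have hlim : ∀ᵐ x ∂(volume : Measure (EuclideanSpace ℝ (Fin d))),
      Tendsto (fun n => ∇ (ψ n) x) atTop (𝓝 (∇ f x)) := by
    have := ContDiffBump.ae_convolution_tendsto_right_of_locallyIntegrable (φ := β) (l := atTop)
      (K := 2) (by
        simpa [β] using (tendsto_one_div_add_atTop_nhds_zero_nat (𝕜 := ℝ)).const_mul 2)
      (Eventually.of_forall fun n => le_rfl) hgint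
    filter_upwards [this] with x hx
    simp_rw [gradient, hder]
    exact ((InnerProductSpace.toDual ℝ _).symm.continuous.tendsto _).comp hx
  exact IsTangentField.of_dominated (b := fun _ => K)
    (fun n => isTangentField_gradient_of_contDiff (hψs n) (hψc n))
    (MemLp.of_bound (measurable_gradient f).aestronglyMeasurable K
      (ae_of_all _ fun x => norm_gradient_le_of_lipschitz hf x))
    (memLp_const _) (fun n => ae_of_all _ fun x => norm_gradient_le_of_lipschitz (hψK n) x)
    (μ.absolutelyContinuous.ae_le hlim)

/-- Gradients of Lipschitz functions are tangent. -/
lemma LipschitzWith.isTangentField_gradient {f : EuclideanSpace ℝ (Fin d) → ℝ} {K : ℝ≥0}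
    (hf : LipschitzWith K f) : IsTangentField μ (∇ f) := by
  let c : ℕ → EuclideanSpace ℝ (Fin d) → ℝ := fun n x => max (n - ‖x‖) 0
  -- Clamping `f` between `±c n` gives compact support with a Lipschitz constant independent of `n`,
  -- and leaves `f` unchanged near any given point for large `n`.
  let g : ℕ → EuclideanSpace ℝ (Fin d) → ℝ := fun n x => max (min (f x) (c n x)) (-c n x)
  have hcL : ∀ n, LipschitzWith 1 (c n) := fun n => by
    have : LipschitzWith 1 fun x : EuclideanSpace ℝ (Fin d) => (n : ℝ) - ‖x‖ :=
      LipschitzWith.of_le_add fun x y => by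
        have := norm_sub_norm_le y x
        rw [dist_eq_norm, norm_sub_rev]
        linarith
    exact this.max_const 0
  have hgL : ∀ n, LipschitzWith (max (max K 1) 1) (g n) := fun n =>
    (hf.min (hcL n)).max (hcL n).neg
  have hgc : ∀ n, HasCompactSupport (g n) := fun n => by
    refine HasCompactSupport.intro (isCompact_closedBall 0 n) fun x hx => ?_
    have : c n x = 0 := max_eq_right (by simpa using le_of_not_ge (by simpa using hx))
    simp [g, this]
  have hlim : ∀ x, Tendsto (fun n => ∇ (g n) x) atTop (𝓝 (∇ f x)) := by
    intro x
    refine tendsto_const_nhds.congr' ?_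
    obtain ⟨N, hN⟩ := exists_nat_gt (|f x| + ‖x‖)
    filter_upwards [eventually_ge_atTop N] with n hn
    have hn' : (N : ℝ) ≤ n := by exact_mod_cast hn
    have hopen : IsOpen {y : EuclideanSpace ℝ (Fin d) | |f y| + ‖y‖ < n} :=
      isOpen_lt (by have := hf.continuous; fun_prop) continuous_const
    have heq : f =ᶠ[𝓝 x] g n := by
      filter_upwards [hopen.mem_nhds (hN.trans_le hn')] with y hy
      have hy' : |f y| ≤ c n y := le_max_of_le_left (by linarith [show |f y| + ‖y‖ < n from hy])
      rw [abs_le] at hy'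
      simp [g, hy'.1, hy'.2]
    rw [gradient, gradient, heq.fderiv_eq]
  exact IsTangentField.of_dominated (b := fun _ => (max (max K 1) 1 : ℝ≥0))
    (fun n => (hgL n).isTangentField_gradient_of_hasCompactSupport (hgc n))
    (MemLp.of_bound (measurable_gradient f).aestronglyMeasurable K
      (ae_of_all _ fun x => norm_gradient_le_of_lipschitz hf x))
    (memLp_const _) (fun n => ae_of_all _ fun x => norm_gradient_le_of_lipschitz (hgL n) x)
    (ae_of_all _ hlim)

/-- The optimal transport map is tangent. -/
theorem IsBrenierPair.isTangentField {ν : P2ac d} {φ ψ : EuclideanSpace ℝ (Fin d) → ℝ}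
    {D D' : Set (EuclideanSpace ℝ (Fin d))}
    (h : IsBrenierPair μ.toMeasure ν.toMeasure φ ψ D D') : IsTangentField μ (∇ φ) := by
  obtain ⟨x₁, hx₁, hc₁⟩ := (h.ae_differentiableAt.and h.ae_contact).exists
  have hx₁D := interior_subset hx₁.1
  set y₁ := ∇ φ x₁
  let K : ℕ → ℝ≥0 := fun n => ‖y₁‖₊ + n
  let J : ℕ → Set (EuclideanSpace ℝ (Fin d)) := fun n => {y | y ∈ D' ∧ ‖y‖ ≤ K n}
  have hJ : ∀ n, Nonempty (J n) := fun n => ⟨⟨y₁, hc₁.1, by simp [K]⟩⟩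
  -- Lipschitz minorants of `φ`, obtained by allowing only slopes of norm at most `K n`. Including
  -- `‖y₁‖` in `K n` keeps the slope set nonempty.
  let f : ℕ → EuclideanSpace ℝ (Fin d) → ℝ := fun n x => ⨆ y : J n, (inner ℝ x (y : _) - ψ y)
  have hbdd : ∀ n x, BddAbove (range fun y : J n =>
      (inner ℝ x (y : EuclideanSpace ℝ (Fin d)) - ψ y)) := by
    rintro n x
    refine ⟨‖x - x₁‖ * K n + φ x₁, ?_⟩
    rintro _ ⟨⟨y, hy, hyK⟩, rfl⟩
    have h1 := h.inner_le x₁ hx₁D y hy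
    have h2 := real_inner_le_norm (x - x₁) y
    have h3 : ‖x - x₁‖ * ‖y‖ ≤ ‖x - x₁‖ * K n := by gcongr
    rw [inner_sub_left] at h2
    dsimp only
    linarith
  have hfL : ∀ n, LipschitzWith (K n) (f n) := by
    intro n
    refine LipschitzWith.of_le_add_mul _ fun x x' => ciSup_le fun y => ?_
    have h1 := le_ciSup (hbdd n x') y
    have h2 := real_inner_le_norm (x - x') y
    have h3 : ‖x - x'‖ * ‖(y : EuclideanSpace ℝ (Fin d))‖ ≤ ‖x - x'‖ * K n := by
      gcongr
      exact y.2.2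
    rw [inner_sub_left] at h2
    rw [dist_eq_norm]
    change _ ≤ f n x' at h1
    linarith
  have hfd : ∀ᵐ x ∂μ.toMeasure, ∀ n, DifferentiableAt ℝ (f n) x :=
    μ.absolutelyContinuous.ae_le (ae_all_iff.2 fun n => (hfL n).ae_differentiableAt)
  -- If the slope `∇ φ x` is allowed, it is a subgradient of `f n` at `x`. Otherwise `‖∇ (f n) x‖ ≤
  -- K n < ‖∇ φ x‖`, so `‖∇ φ‖` dominates in every case.
  have hgrad : ∀ᵐ x ∂μ.toMeasure, ∀ n, ‖∇ φ x‖ ≤ K n → ∇ (f n) x = ∇ φ x := by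
    filter_upwards [hfd, h.ae_differentiableAt, h.ae_contact] with x hxf hxd hxc n hn
    refine (eq_gradient_of_subgradient (D := univ) (by simp) (hxf n) fun z _ => ?_).symm
    have h1 : f n x ≤ φ x := ciSup_le fun y => by
      linarith [h.inner_le x (interior_subset hxd.1) y y.2.1]
    have h2 := le_ciSup (hbdd n z) ⟨∇ φ x, hxc.1, hn⟩
    change _ ≤ f n z at h2
    dsimp only at h2
    rw [inner_sub_left]
    linarith [hxc.2]
  have hT := h.memLp_gradient ν.memLp_id
  refine IsTangentField.of_dominated (fun n => (hfL n).isTangentField_gradient) hT hT.norm ?_ ?_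
  · intro n
    filter_upwards [hgrad] with x hx
    by_cases hn : ‖∇ φ x‖ ≤ K n
    · rw [hx n hn]
    · exact (norm_gradient_le_of_lipschitz (hfL n) x).trans (not_le.1 hn).le
  · filter_upwards [hgrad] with x hx
    refine tendsto_const_nhds.congr' ?_
    obtain ⟨N, hN⟩ := exists_nat_ge ‖∇ φ x‖
    filter_upwards [eventually_ge_atTop N] with n hn
    refine (hx n (hN.trans ?_)).symm
    have hn' : (N : ℝ) ≤ n := by exact_mod_cast hn
    simp only [K, NNReal.coe_add, coe_nnnorm, NNReal.coe_natCast]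
    linarith [norm_nonneg y₁]

/-- The identity is the optimal map from `μ` to itself. -/
lemma isOptimalMap_id (μ : P2ac d) : IsOptimalMap μ μ id :=
  ⟨IsTransportMap.id μ, fun S _ => by simp [transportCost]⟩

lemma IsOptimalMap.isTangentField {ν : P2ac d}
    {T : EuclideanSpace ℝ (Fin d) → EuclideanSpace ℝ (Fin d)} (hT : IsOptimalMap μ ν T) :
    IsTangentField μ T := by
  obtain ⟨φ, ψ, D, D', h⟩ := μ.exists_isBrenierPair ν
  exact h.isTangentField.congr (hT.ae_eq_gradient h).symm

/-- The displacement of an optimal map belongs to the tangent space. -/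
theorem IsOptimalMap.disp_mem {ν : P2ac d}
    {T : EuclideanSpace ℝ (Fin d) → EuclideanSpace ℝ (Fin d)} (hT : IsOptimalMap μ ν T) :
    hT.1.disp ∈ (gradientSubmodule μ).topologicalClosure := by
  obtain ⟨h1, h2⟩ := hT.isTangentField
  obtain ⟨h3, h4⟩ := (isOptimalMap_id μ).isTangentField
  have : hT.1.disp = h1.toLp - h3.toLp := (h1.toLp_sub h3).symm
  rw [this]
  exact Submodule.sub_mem _ h2 h4

end TangentSpace

/-! ### Uniqueness of Wasserstein gradients. -/

section Uniqueness

open Filter Topology Set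

open scoped NNReal

/-- Quadratic bound for the remainder of the first order Taylor expansion. -/
lemma abs_sub_sub_inner_gradient_le {F : Type*} [NormedAddCommGroup F] [InnerProductSpace ℝ F]
    [CompleteSpace F] {ψ : F → ℝ} {L : ℝ≥0} (hψ : Differentiable ℝ ψ)
    (hL : LipschitzWith L (∇ ψ)) (x z : F) :
    |ψ z - ψ x - inner ℝ (∇ ψ x) (z - x)| ≤ L * ‖z - x‖ ^ 2 := by
  have h := (convex_segment x z).norm_image_sub_le_of_norm_fderiv_le' (𝕜 := ℝ) (f := ψ)
    (φ := fderiv ℝ ψ x) (C := L * ‖z - x‖) (fun y _ => hψ y) (fun y hy => ?_)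
    (left_mem_segment ℝ x z) (right_mem_segment ℝ x z)
  · have e : inner ℝ (∇ ψ x) (z - x) = fderiv ℝ ψ x (z - x) := by
      simp [gradient, InnerProductSpace.toDual_symm_apply]
    rw [e, ← Real.norm_eq_abs]
    refine h.trans (le_of_eq (by ring))
  · have e : ‖fderiv ℝ ψ y - fderiv ℝ ψ x‖ = ‖∇ ψ y - ∇ ψ x‖ := by
      rw [gradient, gradient, ← map_sub, LinearIsometryEquiv.norm_map]
    rw [e, ← dist_eq_norm]
    refine (hL.dist_le_mul y x).trans ?_
    gcongr
    rw [dist_eq_norm]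
    exact norm_sub_le_of_mem_segment hy

/-- Haar and top-dimensional Hausdorff measure have the same null sets, and Hausdorff measure scales
under antilipschitz preimages. This makes the perturbed measure absolutely continuous. -/
lemma AntilipschitzWith.measure_preimage_eq_zero {F : Type*} [NormedAddCommGroup F]
    [NormedSpace ℝ F] [FiniteDimensional ℝ F] [MeasurableSpace F] [BorelSpace F]
    {vol : Measure F} [vol.IsAddHaarMeasure] {T : F → F} {K : ℝ≥0} (hT : AntilipschitzWith K T)
    {s : Set F} (hs : vol s = 0) : vol (T ⁻¹' s) = 0 := by
  have h1 : vol ≪ Measure.hausdorffMeasure (Module.finrank ℝ F) :=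
    Measure.absolutelyContinuous_isAddHaarMeasure _ _
  have h2 : Measure.hausdorffMeasure (Module.finrank ℝ F) ≪ vol :=
    Measure.absolutelyContinuous_isAddHaarMeasure _ _
  refine h1 (le_antisymm ((hT.hausdorffMeasure_preimage_le (by positivity) s).trans ?_) bot_le)
  rw [h2 hs, mul_zero]

lemma exists_lipschitzWith_gradient {F : Type*} [NormedAddCommGroup F] [InnerProductSpace ℝ F]
    [FiniteDimensional ℝ F] {ψ : F → ℝ} (hψ : ContDiff ℝ ∞ ψ) (hc : HasCompactSupport ψ) :
    ∃ L, LipschitzWith L (∇ ψ) := by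
  have h1 : ContDiff ℝ ∞ (fderiv ℝ ψ) := hψ.fderiv_right (by simp)
  obtain ⟨L, hL⟩ := ContDiff.lipschitzWith_of_hasCompactSupport (hc.fderiv ℝ) h1 (by simp)
  refine ⟨L, LipschitzWith.of_dist_le_mul fun x y => ?_⟩
  rw [gradient, gradient, LinearIsometryEquiv.dist_map]
  exact hL.dist_le_mul x y

variable {d : ℕ} {μ : P2ac d} {ψ : EuclideanSpace ℝ (Fin d) → ℝ} {L : ℝ≥0} {t : ℝ}

lemma antilipschitzWith_add_smul_gradient (hL : LipschitzWith L (∇ ψ)) (ht : 0 ≤ t)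
    (htL : t * L ≤ 1 / 2) :
    AntilipschitzWith 2 (fun x : EuclideanSpace ℝ (Fin d) => x + t • ∇ ψ x) := by
  refine AntilipschitzWith.of_le_mul_dist fun x y => ?_
  have h1 : ‖t • (∇ ψ x - ∇ ψ y)‖ ≤ 1 / 2 * ‖x - y‖ := by
    rw [norm_smul, Real.norm_of_nonneg ht, ← dist_eq_norm, ← dist_eq_norm]
    calc t * dist (∇ ψ x) (∇ ψ y) ≤ t * (L * dist x y) := by
          gcongr
          exact hL.dist_le_mul x y
      _ = t * L * dist x y := by ring
      _ ≤ 1 / 2 * dist x y := by gcongr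
  have h2 : x - y = ((x + t • ∇ ψ x) - (y + t • ∇ ψ y)) - t • (∇ ψ x - ∇ ψ y) := by
    rw [smul_sub]
    abel
  have h3 := norm_sub_le ((x + t • ∇ ψ x) - (y + t • ∇ ψ y)) (t • (∇ ψ x - ∇ ψ y))
  rw [← h2] at h3
  rw [dist_eq_norm, dist_eq_norm, NNReal.coe_ofNat]
  linarith

/-- Small perturbations of the identity by the gradient of a test function are optimal maps. -/
theorem exists_isOptimalMap_add_smul_gradient (hψ : ContDiff ℝ ∞ ψ) (hc : HasCompactSupport ψ)
    (hL : LipschitzWith L (∇ ψ)) (ht : 0 ≤ t) (htL : t * L ≤ 1 / 2) :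
    ∃ ν : P2ac d, IsOptimalMap μ ν (fun x => x + t • ∇ ψ x) := by
  set T : EuclideanSpace ℝ (Fin d) → EuclideanSpace ℝ (Fin d) := fun x => x + t • ∇ ψ x with hT
  have hanti : AntilipschitzWith 2 T := antilipschitzWith_add_smul_gradient hL ht htL
  have hTL : LipschitzWith (1 + ‖t‖₊ * L) T :=
    LipschitzWith.id.add ((lipschitzWith_smul t).comp hL)
  have hTm : Measurable T := hTL.continuous.measurable
  have hemb : MeasurableEmbedding T :=
    (hanti.isClosedEmbedding hTL.uniformContinuous).measurableEmbedding
  obtain ⟨hg, -⟩ := isTangentField_gradient_of_contDiff (μ := μ) hψ hc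
  have hTLp : MemLp T 2 μ.toMeasure := μ.memLp_id.add (hg.const_smul t)
  have hprob : IsProbabilityMeasure (μ.toMeasure.map T) :=
    Measure.isProbabilityMeasure_map hTm.aemeasurable
  let ν : P2ac d :=
    { toMeasure := μ.toMeasure.map T
      isProbabilityMeasure := hprob
      absolutelyContinuous := by
        refine Measure.AbsolutelyContinuous.mk fun s hs h0 => ?_
        rw [Measure.map_apply hTm hs]
        exact μ.absolutelyContinuous (hanti.measure_preimage_eq_zero h0)
      integrable_norm_sq := by
        rw [integrable_map_measure (by fun_prop) hTm.aemeasurable]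
        exact hTLp.integrable_norm_pow (by norm_num) }
  have hTt : IsTransportMap μ ν T := ⟨hTm, rfl⟩
  refine ⟨ν, hTt, fun S hS => (hTt.transportCost_le_iff hS).2 ?_⟩
  -- With a measurable left inverse `G` of `T`, any competitor is a.e. `T ∘ (G ∘ S)` with `G ∘ S`
  -- preserving `μ`, so the integrals of `φ` cancel.
  obtain ⟨G, hGm, hG⟩ := hemb.exists_measurable_extend measurable_id (fun x => ⟨x⟩)
  have hGT : ∀ x, G (T x) = x := fun x => congrFun hG x
  have hU : MeasurePreserving (G ∘ S) μ.toMeasure μ.toMeasure := by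
    refine ⟨hGm.comp hS.1, ?_⟩
    rw [← Measure.map_map hGm hS.1, hS.2]
    change (μ.toMeasure.map T).map G = _
    rw [Measure.map_map hGm hTm, hG, Measure.map_id]
  have hST : ∀ᵐ x ∂μ.toMeasure, S x = T (G (S x)) := by
    refine hS.measurePreserving.quasiMeasurePreserving.ae (p := fun y => y = T (G y)) ?_
    change ∀ᵐ y ∂(μ.toMeasure.map T), y = T (G y)
    rw [ae_map_iff hTm.aemeasurable (p := fun y => y = T (G y))
      (measurableSet_eq_fun measurable_id (hTm.comp hGm))]
    exact ae_of_all _ fun x => by rw [hGT]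
  -- `T` is the gradient of `φ`; since `t * L ≤ 1 / 2`, the Taylor error of `t * ψ` is absorbed by
  -- the quadratic term, which yields the subgradient inequality `hφ`.
  let φ : EuclideanSpace ℝ (Fin d) → ℝ := fun x => ‖x‖ ^ 2 / 2 + t * ψ x
  have hφ : ∀ x z, inner ℝ z (T x) ≤ φ z - φ x + inner ℝ x (T x) := by
    intro x z
    have h1 := abs_sub_sub_inner_gradient_le (hψ.differentiable (by simp)) hL x z
    have h2 := mul_le_mul_of_nonneg_left (neg_le_of_abs_le h1) ht
    have h3 : t * (L * ‖z - x‖ ^ 2) ≤ 1 / 2 * ‖z - x‖ ^ 2 := by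
      rw [← mul_assoc]
      gcongr
    have h4 : ‖z - x‖ ^ 2 = ‖z‖ ^ 2 - 2 * inner ℝ z x + ‖x‖ ^ 2 := norm_sub_sq_real z x
    have h5 : inner ℝ x x = ‖x‖ ^ 2 := real_inner_self_eq_norm_sq x
    have h6 : inner ℝ (∇ ψ x) (z - x) = inner ℝ z (∇ ψ x) - inner ℝ x (∇ ψ x) := by
      rw [inner_sub_right, real_inner_comm, real_inner_comm x]
    simp only [hT, φ, inner_add_right, real_inner_smul_right]
    rw [h6] at h2
    linarith
  have hφi : Integrable φ μ.toMeasure := by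
    obtain ⟨C, hC⟩ := hc.exists_bound_of_continuous hψ.continuous
    exact (μ.integrable_norm_sq.div_const 2).add
      ((Integrable.of_bound hψ.continuous.aestronglyMeasurable C (ae_of_all _ hC)).const_mul t)
  have hφU : Integrable (fun x => φ (G (S x))) μ.toMeasure :=
    hU.integrable_comp_of_integrable hφi
  have hTi : Integrable (fun x => inner ℝ x (T x)) μ.toMeasure :=
    μ.memLp_id.integrable_inner' hTLp
  have hTU : Integrable (fun x => inner ℝ (G (S x)) (T (G (S x)))) μ.toMeasure :=
    hU.integrable_comp_of_integrable hTi
  have e1 : ∫ x, φ (G (S x)) ∂μ.toMeasure = ∫ x, φ x ∂μ.toMeasure := by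
    conv_rhs => rw [← hU.map_eq, integral_map hU.measurable.aemeasurable (by
      rw [hU.map_eq]
      exact hφi.1)]
    rfl
  have e2 : ∫ x, inner ℝ (G (S x)) (T (G (S x))) ∂μ.toMeasure =
      ∫ x, inner ℝ x (T x) ∂μ.toMeasure := by
    conv_rhs => rw [← hU.map_eq, integral_map hU.measurable.aemeasurable (by fun_prop)]
    rfl
  have k1 : Integrable (fun x => φ x - φ (G (S x))) μ.toMeasure := hφi.sub hφU
  calc ∫ x, inner ℝ x (S x) ∂μ.toMeasure
      ≤ ∫ x, (φ x - φ (G (S x)) + inner ℝ (G (S x)) (T (G (S x)))) ∂μ.toMeasure := by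
        refine integral_mono_ae (μ.memLp_id.integrable_inner' hS.memLp) (k1.add hTU) ?_
        filter_upwards [hST] with x hx
        have := hφ (G (S x)) x
        rwa [← hx] at this ⊢
    _ = ∫ x, inner ℝ x (T x) ∂μ.toMeasure := by
        rw [integral_add k1 hTU, integral_sub hφi hφU, e1, e2]
        ring

/-- The gradient of a functional on the Wasserstein space is unique. -/
theorem HasWassersteinGradient.unique {F : P2ac d → ℝ}
    {v w : Lp (EuclideanSpace ℝ (Fin d)) 2 μ.toMeasure}
    (hv : HasWassersteinGradient F μ v) (hw : HasWassersteinGradient F μ w) : v = w := by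
  have horth : ∀ g ∈ gradientSubmodule μ, inner ℝ (v - w) g = 0 := by
    rintro g ⟨ψ, hψ, hc, hg⟩
    obtain ⟨L, hL⟩ := exists_lipschitzWith_gradient hψ hc
    -- Both expansions are tested on displacement `t • g`, at distance `t * ‖g‖`; subtracting adds
    -- the two errors, and dividing by `t` leaves the factor 2.
    have key : ∀ ε > 0, |inner ℝ (v - w) g| ≤ ε * (2 * ‖g‖) := by
      intro ε hε
      obtain ⟨δ₁, hδ₁, h1⟩ := hv.2 ε hε
      obtain ⟨δ₂, hδ₂, h2⟩ := hw.2 ε hε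
      obtain ⟨t, ht, htL, ht1, ht2⟩ : ∃ t : ℝ, 0 < t ∧ t * L ≤ 1 / 2 ∧ t * ‖g‖ < δ₁ ∧
          t * ‖g‖ < δ₂ := by
        have hlim : ∀ c : ℝ, Tendsto (fun t : ℝ => t * c) (𝓝[>] 0) (𝓝 0) := fun c => by
          have : Tendsto (fun t : ℝ => t * c) (𝓝 0) (𝓝 (0 * c)) :=
            (continuous_id.mul continuous_const).tendsto 0
          rw [zero_mul] at this
          exact this.mono_left nhdsWithin_le_nhds
        obtain ⟨t, h⟩ := (((hlim L).eventually (ge_mem_nhds (by norm_num : (0 : ℝ) < 1 / 2))).and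
          (((hlim ‖g‖).eventually (gt_mem_nhds hδ₁)).and
          (((hlim ‖g‖).eventually (gt_mem_nhds hδ₂)).and self_mem_nhdsWithin))).exists
        exact ⟨t, h.2.2.2, h.1, h.2.1, h.2.2.1⟩
      obtain ⟨ν, hT⟩ := exists_isOptimalMap_add_smul_gradient (μ := μ) hψ hc hL ht.le htL
      have hdisp : hT.1.disp = t • g := by
        refine Lp.ext ?_
        filter_upwards [hT.1.coeFn_disp, Lp.coeFn_smul t g, hg] with x e1 e2 e3
        rw [e1, e2, Pi.smul_apply, e3, add_sub_cancel_left]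
      have hW : W2 μ ν = t * ‖g‖ := by
        rw [hT.W2_eq, hdisp, norm_smul, Real.norm_of_nonneg ht.le]
      have a1 := h1 ν _ hT (by rwa [hW])
      have a2 := h2 ν _ hT (by rwa [hW])
      rw [← hT.1.inner_coeFn_disp, hdisp, real_inner_smul_right, hW] at a1 a2
      have a3 : |t * inner ℝ (v - w) g| ≤ 2 * (ε * (t * ‖g‖)) := by
        rw [inner_sub_left]
        rw [abs_le] at a1 a2 ⊢
        constructor <;> linarith
      rw [abs_mul, abs_of_pos ht] at a3
      have : t * |inner ℝ (v - w) g| ≤ t * (ε * (2 * ‖g‖)) := by linarith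
      exact le_of_mul_le_mul_left this ht
    have hlim : Tendsto (fun ε : ℝ => ε * (2 * ‖g‖)) (𝓝[>] 0) (𝓝 0) := by
      have : Tendsto (fun t : ℝ => t * (2 * ‖g‖)) (𝓝 0) (𝓝 (0 * (2 * ‖g‖))) :=
        (continuous_id.mul continuous_const).tendsto 0
      rw [zero_mul] at this
      exact this.mono_left nhdsWithin_le_nhds
    have := ge_of_tendsto hlim (eventually_mem_nhdsWithin.mono key)
    exact abs_nonpos_iff.1 this
  have hmem : v - w ∈ (gradientSubmodule μ).topologicalClosure :=
    Submodule.sub_mem _ hv.1 hw.1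
  have hclosed : IsClosed {g : Lp (EuclideanSpace ℝ (Fin d)) 2 μ.toMeasure |
      inner ℝ (v - w) g = 0} := isClosed_eq (by fun_prop) continuous_const
  have : inner ℝ (v - w) (v - w) = 0 := closure_minimal horth hclosed hmem
  exact sub_eq_zero.1 (inner_self_eq_zero.1 this)

end Uniqueness

/-! ### The gradient of the variance functional and its Gram form. -/

section VarianceFunctional

open Filter Topology Set

variable {d p : ℕ} {μ₀ : P2ac d} {μ : Fin p → P2ac d}
  {T : Fin p → EuclideanSpace ℝ (Fin d) → EuclideanSpace ℝ (Fin d)}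

/-- The gradient of the variance functional is `-∑ i, λ i • (T i - id)`. -/
theorem hasWassersteinGradient_varianceFunctional (hT : ∀ i, IsOptimalMap μ₀ (μ i) (T i))
    {lam : Fin p → ℝ} (hlam : lam ∈ stdSimplex ℝ (Fin p)) :
    HasWassersteinGradient (varianceFunctional μ lam) μ₀ (-∑ i, lam i • (hT i).1.disp) := by
  constructor
  · rw [wassersteinTangent_eq]
    exact Submodule.neg_mem _ (Submodule.sum_mem _ fun i _ =>
      Submodule.smul_mem _ _ (hT i).disp_mem)
  · intro ε hε
    have hev : ∀ᶠ δ in 𝓝[>] (0 : ℝ), 0 < δ ∧ ∀ i, ∀ (ν : P2ac d) (T₀)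
        (hT₀ : IsOptimalMap μ₀ ν T₀), W2 μ₀ ν < δ →
        |W2sq ν (μ i) / 2 - W2sq μ₀ (μ i) / 2 + inner ℝ (hT i).1.disp hT₀.1.disp| ≤
          ε * W2 μ₀ ν := by
      refine (eventually_mem_nhdsWithin).and (eventually_all.2 fun i => ?_)
      obtain ⟨δ, hδ, h⟩ := (hT i).W2sq_expansion hε
      filter_upwards [Ioo_mem_nhdsGT hδ] with δ' hδ' ν T₀ hT₀ hW
      exact h ν T₀ hT₀ (hW.trans hδ'.2)
    obtain ⟨δ, hδ, h⟩ := hev.exists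
    refine ⟨δ, hδ, fun ν T₀ hT₀ hW => ?_⟩
    rw [← hT₀.1.inner_coeFn_disp, inner_neg_left, sum_inner, varianceFunctional,
      varianceFunctional, ← Finset.sum_sub_distrib, sub_neg_eq_add, ← Finset.sum_add_distrib]
    calc |∑ i, (lam i / 2 * W2sq ν (μ i) - lam i / 2 * W2sq μ₀ (μ i) +
          inner ℝ (lam i • (hT i).1.disp) hT₀.1.disp)|
        ≤ ∑ i, lam i * (ε * W2 μ₀ ν) := by
          refine (Finset.abs_sum_le_sum_abs _ _).trans (Finset.sum_le_sum fun i _ => ?_)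
          -- Each error carries the weight `lam i`; as the weights sum to one, the total stays at `ε
          -- * W2 μ₀ ν`.
          have := mul_le_mul_of_nonneg_left (h i ν T₀ hT₀ hW) (hlam.1 i)
          refine le_trans (le_of_eq ?_) this
          rw [← abs_of_nonneg (hlam.1 i), ← abs_mul, abs_of_nonneg (hlam.1 i),
            real_inner_smul_left]
          congr 1
          ring
      _ = ε * W2 μ₀ ν := by rw [← Finset.sum_mul, hlam.2, one_mul]

lemma displacementGram_eq (hT : ∀ i, IsOptimalMap μ₀ (μ i) (T i)) :
    displacementGram μ₀ T = Matrix.gram ℝ fun i => (hT i).1.disp := by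
  ext i j
  rw [Matrix.gram_apply, (hT i).1.inner_disp (hT j).1]
  rfl

lemma dotProduct_displacementGram (hT : ∀ i, IsOptimalMap μ₀ (μ i) (T i)) (lam : Fin p → ℝ) :
    lam ⬝ᵥ (displacementGram μ₀ T *ᵥ lam) = ‖∑ i, lam i • (hT i).1.disp‖ ^ 2 := by
  rw [displacementGram_eq hT, ← real_inner_self_eq_norm_sq, sum_inner]
  simp only [dotProduct, Matrix.mulVec, Matrix.gram_apply, inner_sum, real_inner_smul_left,
    real_inner_smul_right, Finset.mul_sum]
  refine Finset.sum_congr rfl fun i _ => Finset.sum_congr rfl fun j _ => ?_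
  ring

/-- Uniqueness makes the chosen gradient independent of the choice. -/
lemma HasWassersteinGradient.wassersteinGradient_eq {F : P2ac d → ℝ}
    {v : Lp (EuclideanSpace ℝ (Fin d)) 2 μ₀.toMeasure} (hv : HasWassersteinGradient F μ₀ v) :
    wassersteinGradient F μ₀ = v := by
  have h : ∃ v, HasWassersteinGradient F μ₀ v := ⟨v, hv⟩
  rw [wassersteinGradient, dif_pos h]
  exact h.choose_spec.unique hv

lemma norm_wassersteinGradient_sq (hT : ∀ i, IsOptimalMap μ₀ (μ i) (T i))
    {lam : Fin p → ℝ} (hlam : lam ∈ stdSimplex ℝ (Fin p)) :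
    ‖wassersteinGradient (varianceFunctional μ lam) μ₀‖ ^ 2 =
      lam ⬝ᵥ (displacementGram μ₀ T *ᵥ lam) := by
  rw [(hasWassersteinGradient_varianceFunctional hT hlam).wassersteinGradient_eq, norm_neg,
    dotProduct_displacementGram hT]

lemma convexOn_dotProduct_displacementGram (hT : ∀ i, IsOptimalMap μ₀ (μ i) (T i)) :
    ConvexOn ℝ Set.univ (fun lam : Fin p → ℝ => lam ⬝ᵥ (displacementGram μ₀ T *ᵥ lam)) := by
  simp_rw [dotProduct_displacementGram hT]
  exact ((convexOn_norm convex_univ).pow (fun _ _ => norm_nonneg _) 2).comp_linearMap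
    (Fintype.linearCombination ℝ fun i => (hT i).1.disp)

end VarianceFunctional

theorem proposition1 {d p : ℕ} (μ₀ : P2ac d) (μ : Fin p → P2ac d) :
    -- the optimal transport maps exist and are unique up to null sets
    (∀ i, ∃ T, IsOptimalMap μ₀ (μ i) T ∧
      ∀ T', IsOptimalMap μ₀ (μ i) T' → T' =ᵐ[μ₀.toMeasure] T) ∧
    ∀ T : Fin p → EuclideanSpace ℝ (Fin d) → EuclideanSpace ℝ (Fin d),
      (∀ i, IsOptimalMap μ₀ (μ i) (T i)) →
      -- the entries of the matrix are convergent integrals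
      (∀ i j, Integrable (fun x => inner ℝ (T i x - x) (T j x - x)) μ₀.toMeasure) ∧
      -- the gradient of the variance functional exists, is unique, and has the stated norm
      (∀ lam ∈ stdSimplex ℝ (Fin p),
        (∃! v, HasWassersteinGradient (varianceFunctional μ lam) μ₀ v) ∧
        ‖wassersteinGradient (varianceFunctional μ lam) μ₀‖ ^ 2 =
          lam ⬝ᵥ (displacementGram μ₀ T *ᵥ lam)) ∧
      -- the matrix is positive semidefinite, and the squared norm is convex in the coordinates
      (displacementGram μ₀ T).PosSemidef ∧
      ConvexOn ℝ Set.univ (fun lam : Fin p → ℝ => lam ⬝ᵥ (displacementGram μ₀ T *ᵥ lam)) ∧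
      ConvexOn ℝ (stdSimplex ℝ (Fin p))
        (fun lam => ‖wassersteinGradient (varianceFunctional μ lam) μ₀‖ ^ 2) := by
  refine ⟨fun i => exists_isOptimalMap μ₀ (μ i), fun T hT => ⟨fun i j =>
    (hT i).1.memLp_sub_id.integrable_inner' (hT j).1.memLp_sub_id, fun lam hlam =>
    ⟨?_, norm_wassersteinGradient_sq hT hlam⟩, ?_, convexOn_dotProduct_displacementGram hT, ?_⟩⟩
  · have h := hasWassersteinGradient_varianceFunctional hT hlam
    exact ⟨_, h, fun w hw => hw.unique h⟩
  · rw [displacementGram_eq hT]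
    exact Matrix.posSemidef_gram ℝ _
  -- The Gram form is restricted to the simplex before the congruence, since the identity with the
  -- gradient norm is established only there.
  · exact ((convexOn_dotProduct_displacementGram hT).subset (Set.subset_univ _)
      (convex_stdSimplex ℝ (Fin p))).congr
      fun lam hlam => (norm_wassersteinGradient_sq hT hlam).symm
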